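/- Let $(Y_n)_{n\ge 0}$ be i.i.d. real random variables whose common law $\mu$ is not a point mass and satisfies $\mu(\kappa\mathbb N_0)=1$ for some $\kappa>0$, where $\mathbb N_0=\{0,1,2,\dots\}$ (lattice case, $Y_n\ge 0$). Put $F_\mu(t)=\mu((-\infty,t])$, $d=\gcd \operatorname{supp}(\mu)$ (the largest $\delta>0$ with $\operatorname{supp}(\mu)\subset\delta\mathbb Z$) and $N=\sup\operatorname{supp}(\mu)\in(0,\infty]$. For a starting point $x\ge 0$ let $X_0=x$, $X_{n+1}=|X_n-Y_{n+1}|$ be reflected random walk, let $\mathbf r(0)=0$, $\mathbf r(k+1)=\inf\{n>\mathbf r(k): X_n=-(X_{n-1}-Y_n)\}$ be the reflection times, and let $R_k=X_{\mathbf r(k)}$ be the process of reflections started at $x$. For $x_0\ge 0$ let $$\mathcal C(x_0)=\{kd\pm x_0: k\in\mathbb Z\}\cap[0,\infty)\cap[0,N].$$ A chain is called positive (resp. null) recurrent on a set $\mathcal C$ of states if $\mathcal C$ is an essential class of it (non-empty, and for $x\in\mathcal C$ a state $y$ is reached from $x$ with positive probability at some time if and only if $y\in\mathcal C$) and, for every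 $x\in\mathcal C$, the chain started at $x$ almost surely returns to $x$, with finite (resp. infinite) expected return time. Suppose that the quadratic tail condition $\sum_{k=0}^\infty\bigl(1-F_\mu(\kappa k)\bigr)^2<\infty$ holds (for $\kappa=1$: $\sum_k(1-F_\mu(k))^2<\infty$). Then for every $x_0\ge 0$ the process of reflections $(R_k)$ is positive recurrent on $\mathcal C(x_0)$. Moreover, for every $x_0\ge 0$, the reflected random walk $(X_n)$ is positive recurrent on $\mathcal C(x_0)$ if $\mathbb E(Y_1)<\infty$, and null recurrent on $\mathcal C(x_0)$ if $\mathbb E(Y_1)=\infty$. -/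

import Mathlib

open MeasureTheory ProbabilityTheory

noncomputable section

namespace ReflectedWalk

/-! Recurrence notions for a denumerable Markov chain, given pathwise.

`Z x n ω` is the position at time `n` of the chain started at the deterministic point `x`.
The value `⊤` means that the position is not defined (used for the process of reflections on the
null event where there are only finitely many reflections). -/

section Chain

variable {S Ω : Type*} [MeasurableSpace Ω]

/-- The return time `inf {n ≥ 1 : Z_n = x}` to `x` of the chain started at `x`
(`⊤` if there is no return). -/
def returnTime (Z : S → ℕ → Ω → WithTop S) (x : S) (ω : Ω) : ℕ∞ :=
  sInf ((fun n : ℕ => (n : ℕ∞)) '' {n : ℕ | 1 ≤ n ∧ Z x n ω = (x : WithTop S)})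

/-- The expected return time `E_x(τ_x)`, in `[0, ∞]`. -/
def meanReturnTime (P : Measure Ω) (Z : S → ℕ → Ω → WithTop S) (x : S) : ENNReal :=
  ∫⁻ ω, (returnTime Z x ω : ENNReal) ∂P

/-- An essential class: a non-empty set `C` of states such that for every `x ∈ C`, a state `y` is
reached from `x` with positive probability at some time if and only if `y ∈ C`
(`C` is irreducible and absorbing). -/
def IsEssentialClass (P : Measure Ω) (Z : S → ℕ → Ω → WithTop S) (C : Set S) : Prop :=
  C.Nonempty ∧ ∀ x ∈ C, ∀ y : S, (∃ n : ℕ, 0 < P {ω | Z x n ω = (y : WithTop S)}) ↔ y ∈ C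

/-- The state `x` is recurrent: almost surely, the chain started at `x` returns to `x`. -/
def IsRecurrentState (P : Measure Ω) (Z : S → ℕ → Ω → WithTop S) (x : S) : Prop :=
  ∀ᵐ ω ∂P, returnTime Z x ω < ⊤

/-- `C` is an essential class all of whose states are recurrent with finite mean return time. -/
def IsPositiveRecurrentOn (P : Measure Ω) (Z : S → ℕ → Ω → WithTop S) (C : Set S) : Prop :=
  IsEssentialClass P Z C ∧
    ∀ x ∈ C, IsRecurrentState P Z x ∧ meanReturnTime P Z x < ⊤

/-- `C` is an essential class all of whose states are recurrent with infinite mean return time. -/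
def IsNullRecurrentOn (P : Measure Ω) (Z : S → ℕ → Ω → WithTop S) (C : Set S) : Prop :=
  IsEssentialClass P Z C ∧
    ∀ x ∈ C, IsRecurrentState P Z x ∧ meanReturnTime P Z x = ⊤

end Chain

/-! Reflected random walk and its process of reflections. -/

section Walk

variable {Ω : Type*}

/-- Reflected random walk started at `x`: `X_0 = x`, `X_{n+1} = |X_n - Y_{n+1}|`. -/
def walk (Y : ℕ → Ω → ℝ) (x : ℝ) : ℕ → Ω → ℝ
  | 0, _ => x
  | n + 1, ω => |walk Y x n ω - Y (n + 1) ω|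

/-- The reflection times: `r(0) = 0` and
`r(k+1) = inf {n > r(k) : X_n = -(X_{n-1} - Y_n)}` (`⊤` if there is no such `n`). -/
def reflectionTime (Y : ℕ → Ω → ℝ) (x : ℝ) : ℕ → Ω → ℕ∞
  | 0, _ => 0
  | k + 1, ω => sInf ((fun n : ℕ => (n : ℕ∞)) ''
      {n : ℕ | reflectionTime Y x k ω < (n : ℕ∞) ∧
        walk Y x n ω = -(walk Y x (n - 1) ω - Y n ω)})

/-- Reflected random walk, as a family of processes indexed by the starting point. -/
def walkChain (Y : ℕ → Ω → ℝ) (x : ℝ) (n : ℕ) (ω : Ω) : WithTop ℝ :=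
  (walk Y x n ω : WithTop ℝ)

/-- The process of reflections `R_k = X_{r(k)}` (`⊤` where `r(k) = ⊤`), as a family of processes
indexed by the starting point. -/
def reflectionChain (Y : ℕ → Ω → ℝ) (x : ℝ) (k : ℕ) (ω : Ω) : WithTop ℝ :=
  ENat.map (fun n : ℕ => walk Y x n ω) (reflectionTime Y x k ω)

end Walk

/-- `d = gcd (supp μ)`: the largest `δ > 0` such that all elements of `supp μ` are integer
multiples of `δ`. -/
def suppGcd (μ : Measure ℝ) : ℝ :=
  sSup {δ : ℝ | 0 < δ ∧ ∀ s ∈ μ.support, ∃ k : ℤ, s = k * δ}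

/-- `N = sup (supp μ)`, possibly infinite. -/
def suppSup (μ : Measure ℝ) : EReal :=
  sSup ((fun s : ℝ => (s : EReal)) '' μ.support)

/-- The state space `{k d ± x₀ : k ∈ ℤ} ∩ [0, ∞)`. -/
def stateSpace (μ : Measure ℝ) (x₀ : ℝ) : Set ℝ :=
  {y : ℝ | 0 ≤ y ∧ ∃ k : ℤ, y = k * suppGcd μ + x₀ ∨ y = k * suppGcd μ - x₀}

/-- The class `C(x₀)`: the points of the state space that lie in `[0, N]`. -/
def essentialClass (μ : Measure ℝ) (x₀ : ℝ) : Set ℝ :=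
  {y : ℝ | y ∈ stateSpace μ x₀ ∧ (y : EReal) ≤ suppSup μ}

end ReflectedWalk

end

/-!
Everything rests on one explicit excessive measure. Up to a factor, the reflected walk has the
invariant measure `w ↦ μ [w, ∞) + μ (w, ∞)` for `w > 0`, with weight `μ (0, ∞)` at `0`
(`weight`). Its excessiveness (`tsum_weight_mul_le`) is a symmetry: for two independent increments
`s` and `t`, exchanging them turns the mass that flows into `y` into the probabilities of `s ≥ y`
and `s > y`.

An excessive measure bounds occupation measures of excursions (`mul_tsum_alive_le`): if the weight
dominates its image under the moves outside a set `K` together with a mass `c` at `x`, then it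
dominates `c` times the expected number of visits before the first move in `K`.

* For the process of reflections, `K` is the set of moves that reflect to `x`. The return time is at
  most the number of reflecting moves made before the walk reflects to `x`, whose expectation is
  then bounded by a multiple of `∑ weight w * μ [w, ∞)`; the quadratic tail condition says that this
  sum over the class is finite. Finiteness of the mean gives recurrence, because the walk is
  reflected infinitely often. No strong Markov property at the reflection times is needed.
* For the walk, `K` is the set of all moves to `x`. The mean return time is bounded by a multiple of
  the total weight of the class, which is finite when the mean of `μ` is finite. If the mean is
  infinite, so is the total weight, while the walk is still recurrent because the process of
  reflections is. A finite mean return time would then make the occupation measure of an excursion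
  a finite invariant measure proportional to the weight
  (`meanReturnTime_walkChain_eq_top`).

Irreducibility (`reach_of_mem_essentialClass`) comes from the reversibility of the step relation
(`reach_reverse_step`): the states that communicate with a given one are invariant under the group
spanned by the increments once the line is folded by the absolute value (unbounded increments) or
wrapped onto `[0, N)` (largest increment `N`).
-/

namespace ReflectedWalk

/-! ### The support of a lattice law -/

/-- The set of atoms of `μ`. For a law on a lattice it is the support, and working with points of
positive mass avoids all topology later on. -/
def atoms (μ : Measure ℝ) : Set ℝ := {s | μ {s} ≠ 0}

section Lattice

variable {μ : Measure ℝ} {κ : ℝ}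

lemma exists_nat_of_mem_atoms (hlattice : ∀ᵐ y ∂μ, ∃ m : ℕ, y = κ * m) {s : ℝ}
    (hs : s ∈ atoms μ) : ∃ m : ℕ, s = κ * m := by
  by_contra h
  exact hs (measure_mono_null (by simpa using h) (ae_iff.1 hlattice))

lemma atoms_nonneg (hκ : 0 < κ) (hlattice : ∀ᵐ y ∂μ, ∃ m : ℕ, y = κ * m) {s : ℝ}
    (hs : s ∈ atoms μ) : 0 ≤ s := by
  obtain ⟨m, rfl⟩ := exists_nat_of_mem_atoms hlattice hs
  positivity

lemma ae_mem_atoms (hlattice : ∀ᵐ y ∂μ, ∃ m : ℕ, y = κ * m) : ∀ᵐ y ∂μ, y ∈ atoms μ := by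
  have h : ∀ m : ℕ, ∀ᵐ y ∂μ, y = κ * m → y ∈ atoms μ := by
    intro m
    by_cases hm : κ * m ∈ atoms μ
    · exact Filter.Eventually.of_forall fun y hy => hy ▸ hm
    · refine measure_mono_null ?_ (not_not.1 hm : μ {κ * (m : ℝ)} = 0)
      intro y hy
      simp only [Set.mem_compl_iff, Set.mem_ofPred_eq, Classical.not_imp] at hy
      exact hy.1
  filter_upwards [hlattice, ae_all_iff.2 h] with y ⟨m, hm⟩ hy using hy m hm

lemma ae_nonneg_of_lattice (hκ : 0 < κ) (hlattice : ∀ᵐ y ∂μ, ∃ m : ℕ, y = κ * m) :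
    ∀ᵐ s ∂μ, 0 ≤ s := by
  filter_upwards [ae_mem_atoms hlattice] with s hs using atoms_nonneg hκ hlattice hs

lemma support_eq_atoms (hκ : 0 < κ) (hlattice : ∀ᵐ y ∂μ, ∃ m : ℕ, y = κ * m) :
    μ.support = atoms μ := by
  refine Set.Subset.antisymm (Measure.support_subset_of_isClosed ?_ (ae_mem_atoms hlattice)) ?_
  · have himg : atoms μ = (fun x => κ * x) '' ((fun n : ℤ => (n : ℝ)) ''
        {n : ℤ | κ * n ∈ atoms μ}) := by
      ext s
      constructor
      · intro hs
        obtain ⟨m, rfl⟩ := exists_nat_of_mem_atoms hlattice hs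
        exact ⟨m, ⟨m, by simpa using hs, by simp⟩, rfl⟩
      · rintro ⟨_, ⟨n, hn, rfl⟩, rfl⟩
        exact hn
    rw [himg]
    exact (Homeomorph.mulLeft₀ κ hκ.ne').isClosedMap _
      (Int.isClosedEmbedding_coe_real.isClosedMap _ (isClosed_discrete _))
  · intro s hs
    rw [Measure.mem_support_iff_forall]
    exact fun U hU => (pos_iff_ne_zero.2 hs).trans_le
      (measure_mono (Set.singleton_subset_iff.2 (mem_of_mem_nhds hU)))

lemma atoms_nonempty [IsProbabilityMeasure μ] (hlattice : ∀ᵐ y ∂μ, ∃ m : ℕ, y = κ * m) :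
    (atoms μ).Nonempty :=
  (ae_mem_atoms hlattice).exists

/-- Only the point mass at `0` has no positive atom. -/
lemma exists_pos_mem_atoms [IsProbabilityMeasure μ] (hκ : 0 < κ)
    (hlattice : ∀ᵐ y ∂μ, ∃ m : ℕ, y = κ * m) (hnondeg : μ ≠ Measure.dirac 0) :
    ∃ s ∈ atoms μ, 0 < s := by
  by_contra! h
  refine hnondeg ?_
  have h0 : ∀ᵐ y ∂μ, y = (0 : ℝ) := by
    filter_upwards [ae_mem_atoms hlattice] with y hy
    exact le_antisymm (h y hy) (atoms_nonneg hκ hlattice hy)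
  have hmap : μ.map id = μ.map fun _ => (0 : ℝ) := Measure.map_congr h0
  simpa [Measure.map_const] using hmap

/-- The supremum defining `suppGcd μ` is attained: it generates the subgroup spanned by the
atoms. -/
lemma suppGcd_spec [IsProbabilityMeasure μ] (hκ : 0 < κ)
    (hlattice : ∀ᵐ y ∂μ, ∃ m : ℕ, y = κ * m) (hnondeg : μ ≠ Measure.dirac 0) :
    0 < suppGcd μ ∧ AddSubgroup.closure (atoms μ) = AddSubgroup.zmultiples (suppGcd μ) ∧
      κ ≤ suppGcd μ := by
  obtain ⟨s, hs, hs0⟩ := exists_pos_mem_atoms hκ hlattice hnondeg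
  have hle : AddSubgroup.closure (atoms μ) ≤ AddSubgroup.zmultiples κ := by
    rw [AddSubgroup.closure_le]
    intro t ht
    obtain ⟨m, rfl⟩ := exists_nat_of_mem_atoms hlattice ht
    exact AddSubgroup.mem_zmultiples_iff.2 ⟨m, by simp [mul_comm]⟩
  obtain ⟨g, hg0, hg⟩ : ∃ g : ℝ, 0 ≤ g ∧
      AddSubgroup.closure (atoms μ) = AddSubgroup.zmultiples g := by
    have hcyc : IsAddCyclic (AddSubgroup.closure (atoms μ)) :=
      isAddCyclic_of_injective (AddSubgroup.inclusion hle) (AddSubgroup.inclusion_injective hle)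
    obtain ⟨g, hg⟩ := (AddSubgroup.isAddCyclic_iff_exists_zmultiples_eq_top _).1 hcyc
    rcases le_total 0 g with h | h
    · exact ⟨g, h, hg.symm⟩
    · exact ⟨-g, by linarith, by rw [AddSubgroup.zmultiples_neg, hg]⟩
  have hgpos : 0 < g := by
    refine hg0.lt_of_ne' fun h => hs0.ne' ?_
    have : s ∈ AddSubgroup.zmultiples g := hg ▸ AddSubgroup.subset_closure hs
    simpa [h] using this
  have hmem : ∀ t ∈ atoms μ, ∃ k : ℤ, t = k * g := by
    intro t ht
    have : t ∈ AddSubgroup.zmultiples g := hg ▸ AddSubgroup.subset_closure ht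
    obtain ⟨k, hk⟩ := AddSubgroup.mem_zmultiples_iff.1 this
    exact ⟨k, by simpa using hk.symm⟩
  -- A common divisor of the atoms divides every element of the subgroup, in particular `g`.
  have hub : ∀ δ : ℝ, 0 < δ → (∀ t ∈ atoms μ, ∃ k : ℤ, t = k * δ) → δ ≤ g := by
    intro δ hδ h
    have hle' : AddSubgroup.closure (atoms μ) ≤ AddSubgroup.zmultiples δ := by
      rw [AddSubgroup.closure_le]
      intro t ht
      obtain ⟨k, rfl⟩ := h t ht
      exact AddSubgroup.mem_zmultiples_iff.2 ⟨k, by simp⟩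
    have hgmem : g ∈ AddSubgroup.closure (atoms μ) := hg ▸ AddSubgroup.mem_zmultiples g
    obtain ⟨k, hk⟩ := AddSubgroup.mem_zmultiples_iff.1 (hle' hgmem)
    rw [zsmul_eq_mul] at hk
    have hk1 : 1 ≤ k := by
      have : (0 : ℝ) < k := by
        by_contra hneg
        nlinarith
      exact_mod_cast this
    have : (1 : ℝ) ≤ k := by exact_mod_cast hk1
    nlinarith
  have hgcd : suppGcd μ = g := by
    rw [suppGcd, support_eq_atoms hκ hlattice]
    exact IsGreatest.csSup_eq ⟨⟨hgpos, hmem⟩, fun δ hδ => hub δ hδ.1 hδ.2⟩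
  rw [hgcd]
  refine ⟨hgpos, hg, hub κ hκ fun t ht => ?_⟩
  obtain ⟨m, rfl⟩ := exists_nat_of_mem_atoms hlattice ht
  exact ⟨m, by simp [mul_comm]⟩

/-- A point lies below `suppSup μ` exactly when it lies below some atom: an infinite supremum
leaves room, and a finite one is attained since the atoms are discrete. -/
lemma le_suppSup_iff [IsProbabilityMeasure μ] (hκ : 0 < κ)
    (hlattice : ∀ᵐ y ∂μ, ∃ m : ℕ, y = κ * m) {y : ℝ} :
    (y : EReal) ≤ suppSup μ ↔ ∃ s ∈ atoms μ, y ≤ s := by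
  rw [suppSup, support_eq_atoms hκ hlattice]
  constructor
  · intro h
    by_contra! hlt
    obtain ⟨s₀, hs₀⟩ := atoms_nonempty hlattice
    -- The atoms below `y` have a largest element, by boundedness of their indices.
    obtain ⟨M, hM⟩ := exists_nat_gt (y / κ)
    have hfin : (atoms μ).Finite := by
      refine ((Set.finite_Iio M).image fun m : ℕ => κ * (m : ℝ)).subset fun s hs => ?_
      obtain ⟨m, rfl⟩ := exists_nat_of_mem_atoms hlattice hs
      refine ⟨m, ?_, rfl⟩
      have h1 := hlt _ hs
      have h2 : (m : ℝ) < M := lt_trans (by rw [lt_div_iff₀ hκ]; linarith) hM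
      exact_mod_cast h2
    obtain ⟨t, ht, hmax⟩ := hfin.exists_maximalFor id _ ⟨s₀, hs₀⟩
    have hle : sSup ((fun s : ℝ => (s : EReal)) '' atoms μ) ≤ (t : EReal) := by
      refine sSup_le ?_
      rintro _ ⟨s, hs, rfl⟩
      rcases le_total s t with h' | h'
      · exact EReal.coe_le_coe_iff.2 h'
      · exact EReal.coe_le_coe_iff.2 (hmax hs h')
    exact absurd (EReal.coe_le_coe_iff.1 (h.trans hle)) (not_le.2 (hlt t ht))
  · rintro ⟨s, hs, hys⟩
    exact (EReal.coe_le_coe_iff.2 hys).trans (le_sSup ⟨s, hs, rfl⟩)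

end Lattice

/-! ### Irreducibility -/

/-- `y` can be reached from `x` by finitely many steps `w ↦ |w - s|` with increments `s ∈ A`. -/
def Reach (A : Set ℝ) : ℝ → ℝ → Prop :=
  Relation.ReflTransGen fun w y => ∃ s ∈ A, y = |w - s|

section Reach

variable {A : Set ℝ} {x y s N : ℝ}

lemma Reach.of_step (hs : s ∈ A) (h : y = |x - s|) : Reach A x y :=
  Relation.ReflTransGen.single ⟨s, hs, h⟩

/-- Every step between states below some increment can be undone. A step that reflects is undone
by the same increment; a step `w ↦ w - s` is undone by `N`, `s`, `N` in succession, where `N` is an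
increment above `w`. -/
lemma reach_reverse_step (hA : ∀ s ∈ A, 0 ≤ s) {w : ℝ} (hw : 0 ≤ w) (hN : N ∈ A) (hwN : w ≤ N)
    (hs : s ∈ A) : Reach A |w - s| w := by
  have hs0 := hA s hs
  rcases le_total w s with h | h
  · refine Reach.of_step hs ?_
    rw [abs_of_nonpos (by linarith : w - s ≤ 0), abs_of_nonpos (by linarith)]
    ring
  · rw [abs_of_nonneg (by linarith : 0 ≤ w - s)]
    have h1 : Reach A (w - s) (N - w + s) := by
      refine Reach.of_step hN ?_
      rw [abs_of_nonpos (by linarith)]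
      ring
    have h2 : Reach A (N - w + s) (N - w) := by
      refine Reach.of_step hs ?_
      rw [abs_of_nonneg (by linarith)]
      ring
    have h3 : Reach A (N - w) w := by
      refine Reach.of_step hN ?_
      rw [abs_of_nonpos (by linarith)]
      ring
    exact (h1.trans h2).trans h3

lemma Reach.mem_domain (hA : ∀ s ∈ A, 0 ≤ s) (h : Reach A x y) (hx : 0 ≤ x)
    (hxA : ∃ s ∈ A, x ≤ s) : 0 ≤ y ∧ ∃ s ∈ A, y ≤ s := by
  induction h with
  | refl => exact ⟨hx, hxA⟩
  | @tail b c _ hbc ih =>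
    obtain ⟨s, hs, rfl⟩ := hbc
    obtain ⟨hb, N, hN, hbN⟩ := ih
    refine ⟨abs_nonneg _, ?_⟩
    rcases le_total b s with h | h
    · exact ⟨s, hs, by rw [abs_of_nonpos (by linarith)]; linarith⟩
    · exact ⟨N, hN, by rw [abs_of_nonneg (by linarith)]; linarith [hA s hs]⟩

lemma Reach.symm (hA : ∀ s ∈ A, 0 ≤ s) (h : Reach A x y) (hx : 0 ≤ x)
    (hxA : ∃ s ∈ A, x ≤ s) : Reach A y x := by
  induction h with
  | refl => exact Relation.ReflTransGen.refl
  | @tail b c hb hbc ih =>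
    obtain ⟨s, hs, rfl⟩ := hbc
    obtain ⟨hb0, N, hN, hbN⟩ := Reach.mem_domain hA hb hx hxA
    exact (reach_reverse_step hA hb0 hN hbN hs).trans ih

/-- For unbounded increments, translating by the group they span stays inside one communicating
class, once the line is folded onto the half-line by the absolute value. -/
lemma reach_abs_add (hA : ∀ s ∈ A, 0 ≤ s) (hunb : ∀ w : ℝ, ∃ s ∈ A, w ≤ s) {t : ℝ}
    (ht : t ∈ AddSubgroup.closure A) : ∀ x : ℝ, Reach A |x| |x + t| := by
  induction ht using AddSubgroup.closure_induction with
  | mem s hs =>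
    intro x
    refine Reach.symm hA ?_ (abs_nonneg _) (hunb _)
    rcases le_total 0 (x + s) with h | h
    · refine Reach.of_step hs ?_
      rw [abs_of_nonneg h]
      congr 1
      ring
    · -- On the negative side the step points away from the origin and has to be reversed.
      refine Reach.symm hA (Reach.of_step hs ?_) (abs_nonneg _) (hunb _)
      have hs0 := hA s hs
      rw [abs_of_nonpos h, abs_of_nonpos (by linarith : x ≤ 0), abs_of_nonneg (by linarith)]
      ring
  | zero =>
    intro x
    rw [add_zero]
    exact Relation.ReflTransGen.refl
  | add a b _ _ iha ihb =>
    intro x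
    have := (iha x).trans (ihb (x + a))
    rwa [add_assoc] at this
  | neg a _ ih =>
    intro x
    have := ih (x + -a)
    rw [neg_add_cancel_right] at this
    exact this.symm hA (abs_nonneg _) (hunb _)

/-- If `N` is the largest increment, then translating by the group spanned by the increments stays
inside one communicating class, once the line is wrapped onto `[0, N)`. -/
lemma reach_toIcoMod_add (hA : ∀ s ∈ A, 0 ≤ s) (hN0 : 0 < N) (hN : N ∈ A)
    (hmax : ∀ s ∈ A, s ≤ N) {t : ℝ} (ht : t ∈ AddSubgroup.closure A) :
    ∀ x : ℝ, Reach A (toIcoMod hN0 0 x) (toIcoMod hN0 0 (x + t)) := by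
  have hdom : ∀ x, 0 ≤ toIcoMod hN0 0 x ∧ toIcoMod hN0 0 x < N := fun x => by
    simpa using toIcoMod_mem_Ico hN0 0 x
  induction ht using AddSubgroup.closure_induction with
  | mem s hs =>
    intro x
    refine Reach.symm hA ?_ (hdom _).1 ⟨N, hN, (hdom _).2.le⟩
    obtain ⟨h0, h1⟩ := hdom (x + s)
    have hs0 := hA s hs
    have hsN := hmax s hs
    have hx : x + s = toIcoMod hN0 0 (x + s) + toIcoDiv hN0 0 (x + s) • N :=
      (toIcoMod_add_toIcoDiv_zsmul hN0 0 (x + s)).symm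
    set w := toIcoMod hN0 0 (x + s) with hw
    set z := toIcoDiv hN0 0 (x + s) with hz
    rcases le_or_gt s w with h | h
    · have : toIcoMod hN0 0 x = w - s := by
        rw [toIcoMod_eq_iff]
        exact ⟨⟨by linarith, by linarith⟩, z, by linarith⟩
      rw [this]
      exact Reach.of_step hs (abs_of_nonneg (by linarith)).symm
    · -- The wrapped target `w - s + N` is reached by reflecting at `s` and then at `N`.
      have : toIcoMod hN0 0 x = w - s + N := by
        rw [toIcoMod_eq_iff]
        refine ⟨⟨by linarith, by linarith⟩, z - 1, ?_⟩
        rw [sub_smul, one_smul]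
        linarith
      rw [this]
      have h2 : Reach A w (s - w) := by
        refine Reach.of_step hs ?_
        rw [abs_of_nonpos (by linarith)]
        ring
      refine h2.trans (Reach.of_step hN ?_)
      rw [abs_of_nonpos (by linarith)]
      ring
  | zero =>
    intro x
    rw [add_zero]
    exact Relation.ReflTransGen.refl
  | add a b _ _ iha ihb =>
    intro x
    have := (iha x).trans (ihb (x + a))
    rwa [add_assoc] at this
  | neg a _ ih =>
    intro x
    have := ih (x + -a)
    rw [neg_add_cancel_right] at this
    exact this.symm hA (hdom _).1 ⟨N, hN, (hdom _).2.le⟩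

/-- Two states below some increment communicate if they differ by an element of the group spanned
by the increments, up to the sign of one of them. -/
lemma reach_of_mem_closure (hA : ∀ s ∈ A, 0 ≤ s) (hpos : ∃ s ∈ A, 0 < s) (hx : 0 ≤ x)
    (hxA : ∃ s ∈ A, x ≤ s) (hy : 0 ≤ y) (hyA : ∃ s ∈ A, y ≤ s)
    (hfin : ∀ w : ℝ, (A ∩ Set.Iic w).Finite)
    (h : y - x ∈ AddSubgroup.closure A ∨ y + x ∈ AddSubgroup.closure A) : Reach A x y := by
  by_cases hunb : ∀ w : ℝ, ∃ s ∈ A, w ≤ s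
  · rcases h with h | h
    · have := reach_abs_add hA hunb h x
      rwa [add_sub_cancel, abs_of_nonneg hx, abs_of_nonneg hy] at this
    · have := reach_abs_add hA hunb h (-x)
      rwa [neg_add_eq_sub, add_sub_cancel_right, abs_neg, abs_of_nonneg hx,
        abs_of_nonneg hy] at this
  · push Not at hunb
    obtain ⟨M, hM⟩ := hunb
    have hAfin : A.Finite := by
      refine (hfin M).subset fun s hs => ⟨hs, (hM s hs).le⟩
    obtain ⟨s₁, hs₁, hs₁0⟩ := hpos
    obtain ⟨N, hN, hmax⟩ := hAfin.exists_maximalFor id _ ⟨s₁, hs₁⟩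
    replace hmax : ∀ s ∈ A, s ≤ N := fun s hs => by
      rcases le_total s N with h' | h'
      · exact h'
      · exact hmax hs h'
    have hN0 : 0 < N := hs₁0.trans_le (hmax _ hs₁)
    have hle : ∀ {w : ℝ}, (∃ s ∈ A, w ≤ s) → w ≤ N := fun ⟨s, hs, hws⟩ => hws.trans (hmax s hs)
    -- Wrapping changes a state of `[0, N]` only if it is `N`, which communicates with `0`.
    have hwrap : ∀ w : ℝ, 0 ≤ w → w ≤ N → Reach A w (toIcoMod hN0 0 w) := by
      intro w hw hwN
      rcases hwN.lt_or_eq with h' | rfl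
      · rw [(toIcoMod_eq_iff hN0).2 ⟨⟨hw, by simpa using h'⟩, 0, by simp⟩]
        exact Relation.ReflTransGen.refl
      · rw [(toIcoMod_eq_iff hN0 (c := 0)).2 ⟨⟨le_rfl, by simpa using hN0⟩, 1, by simp⟩]
        exact Reach.of_step hN (by simp)
    have hyy : Reach A (toIcoMod hN0 0 y) y :=
      (hwrap y hy (hle hyA)).symm hA hy hyA
    have hxN := hle hxA
    rcases h with h | h
    · have := reach_toIcoMod_add hA hN0 hN hmax h x
      rw [add_sub_cancel] at this
      exact ((hwrap x hx hxN).trans this).trans hyy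
    · have hmem : y + x - N ∈ AddSubgroup.closure A :=
        AddSubgroup.sub_mem _ h (AddSubgroup.subset_closure hN)
      have := reach_toIcoMod_add hA hN0 hN hmax hmem (N - x)
      rw [show N - x + (y + x - N) = y by ring] at this
      have h1 : Reach A x (N - x) :=
        Reach.of_step hN (by rw [abs_of_nonpos (by linarith)]; ring)
      exact ((h1.trans (hwrap _ (by linarith) (by linarith))).trans this).trans hyy

end Reach

section Class

variable {μ : Measure ℝ} {κ : ℝ}

lemma mem_essentialClass_iff [IsProbabilityMeasure μ] (hκ : 0 < κ)
    (hlattice : ∀ᵐ y ∂μ, ∃ m : ℕ, y = κ * m) {x₀ y : ℝ} :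
    y ∈ essentialClass μ x₀ ↔ y ∈ stateSpace μ x₀ ∧ ∃ s ∈ atoms μ, y ≤ s := by
  rw [← le_suppSup_iff hκ hlattice]
  rfl

lemma step_mem_essentialClass [IsProbabilityMeasure μ] (hκ : 0 < κ)
    (hlattice : ∀ᵐ y ∂μ, ∃ m : ℕ, y = κ * m) (hnondeg : μ ≠ Measure.dirac 0) {x₀ w s : ℝ}
    (hw : w ∈ essentialClass μ x₀) (hs : s ∈ atoms μ) : |w - s| ∈ essentialClass μ x₀ := by
  rw [mem_essentialClass_iff hκ hlattice] at hw ⊢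
  obtain ⟨⟨hw0, k, hk⟩, hwA⟩ := hw
  refine ⟨⟨abs_nonneg _, ?_⟩, ((Reach.of_step hs rfl).mem_domain
    (fun s hs => atoms_nonneg hκ hlattice hs) hw0 hwA).2⟩
  have hmem : s ∈ AddSubgroup.zmultiples (suppGcd μ) :=
    (suppGcd_spec hκ hlattice hnondeg).2.1 ▸ AddSubgroup.subset_closure hs
  obtain ⟨j, rfl⟩ := AddSubgroup.mem_zmultiples_iff.1 hmem
  rw [zsmul_eq_mul]
  rcases abs_choice (w - j * suppGcd μ) with h | h <;> rw [h]
  · refine ⟨k - j, ?_⟩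
    push_cast
    rcases hk with rfl | rfl
    · left; ring
    · right; ring
  · refine ⟨j - k, ?_⟩
    push_cast
    rcases hk with rfl | rfl
    · right; ring
    · left; ring

lemma essentialClass_nonempty [IsProbabilityMeasure μ] (hκ : 0 < κ)
    (hlattice : ∀ᵐ y ∂μ, ∃ m : ℕ, y = κ * m) (hnondeg : μ ≠ Measure.dirac 0) {x₀ : ℝ} :
    (essentialClass μ x₀).Nonempty := by
  obtain ⟨hd, hcl, -⟩ := suppGcd_spec hκ hlattice hnondeg
  obtain ⟨s, hs, hs0⟩ := exists_pos_mem_atoms hκ hlattice hnondeg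
  have hmem : s ∈ AddSubgroup.zmultiples (suppGcd μ) := hcl ▸ AddSubgroup.subset_closure hs
  obtain ⟨j, rfl⟩ := AddSubgroup.mem_zmultiples_iff.1 hmem
  -- The residue of `x₀` modulo the step length lies below every positive atom.
  refine ⟨toIcoMod hd 0 x₀, (mem_essentialClass_iff hκ hlattice).2
    ⟨⟨left_le_toIcoMod _ _ _, -toIcoDiv hd 0 x₀, Or.inl ?_⟩, _, hs, ?_⟩⟩
  · have := toIcoMod_add_toIcoDiv_zsmul hd 0 x₀
    rw [zsmul_eq_mul] at this
    push_cast
    linarith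
  · have h1 := toIcoMod_lt_right hd 0 x₀
    rw [zsmul_eq_mul] at hs0 ⊢
    have hj : (0 : ℝ) < j := by
      by_contra hneg
      nlinarith
    have hj1 : (1 : ℝ) ≤ j := by
      have : 0 < j := by exact_mod_cast hj
      exact_mod_cast this
    nlinarith

lemma reach_of_mem_essentialClass [IsProbabilityMeasure μ] (hκ : 0 < κ)
    (hlattice : ∀ᵐ y ∂μ, ∃ m : ℕ, y = κ * m) (hnondeg : μ ≠ Measure.dirac 0) {x₀ x y : ℝ}
    (hx : x ∈ essentialClass μ x₀) (hy : y ∈ essentialClass μ x₀) : Reach (atoms μ) x y := by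
  rw [mem_essentialClass_iff hκ hlattice] at hx hy
  obtain ⟨⟨hx0, k, hk⟩, hxA⟩ := hx
  obtain ⟨⟨hy0, j, hj⟩, hyA⟩ := hy
  refine reach_of_mem_closure (fun s hs => atoms_nonneg hκ hlattice hs)
    (exists_pos_mem_atoms hκ hlattice hnondeg) hx0 hxA hy0 hyA (fun w => ?_) ?_
  · obtain ⟨M, hM⟩ := exists_nat_gt (w / κ)
    refine ((Set.finite_Iio M).image fun m : ℕ => κ * (m : ℝ)).subset fun s hs => ?_
    obtain ⟨m, rfl⟩ := exists_nat_of_mem_atoms hlattice hs.1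
    refine ⟨m, ?_, rfl⟩
    have h1 : κ * (m : ℝ) ≤ w := hs.2
    have h2 : (m : ℝ) < M := lt_of_le_of_lt (by rw [le_div_iff₀ hκ]; linarith) hM
    exact_mod_cast h2
  · rw [(suppGcd_spec hκ hlattice hnondeg).2.1]
    simp only [AddSubgroup.mem_zmultiples_iff, zsmul_eq_mul]
    rcases hk with rfl | rfl <;> rcases hj with rfl | rfl
    · exact Or.inl ⟨j - k, by push_cast; ring⟩
    · exact Or.inr ⟨j + k, by push_cast; ring⟩
    · exact Or.inr ⟨j + k, by push_cast; ring⟩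
    · exact Or.inl ⟨j - k, by push_cast; ring⟩

lemma essentialClass_countable (μ : Measure ℝ) (x₀ : ℝ) : (essentialClass μ x₀).Countable := by
  refine ((Set.countable_range fun k : ℤ => k * suppGcd μ + x₀).union
    (Set.countable_range fun k : ℤ => k * suppGcd μ - x₀)).mono ?_
  rintro y ⟨⟨-, k, h | h⟩, -⟩
  · exact Or.inl ⟨k, h.symm⟩
  · exact Or.inr ⟨k, h.symm⟩

end Class

/-! ### An excessive measure for the walk -/

/-- The weight `μ [w, ∞) + μ (w, ∞)` of a state `w > 0`, the weight `μ (0, ∞)` of the state `0`, and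
weight zero on negative numbers. Up to a constant this is the invariant measure of the
reflected walk. It is written with conditions inside the sets so that it becomes an
event for a pair of independent increments once `w` is replaced by a function of the other one. -/
noncomputable def weight (μ : Measure ℝ) (w : ℝ) : ENNReal :=
  μ {t | 0 < w ∧ w ≤ t} + μ {t | 0 ≤ w ∧ w < t}

section Excessive

variable {μ : Measure ℝ}

lemma weight_le (w : ℝ) : weight μ w ≤ 2 * μ (Set.Ici w) := by
  rw [two_mul]
  exact add_le_add (measure_mono fun t ht => ht.2) (measure_mono fun t ht => ht.2.le)

lemma weight_ne_top [IsProbabilityMeasure μ] (w : ℝ) : weight μ w ≠ ⊤ :=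
  ENNReal.add_ne_top.2 ⟨measure_ne_top _ _, measure_ne_top _ _⟩

lemma measure_Ici_le_weight {w : ℝ} (hw : 0 < w) : μ (Set.Ici w) ≤ weight μ w :=
  le_add_right (measure_mono fun _ ht => ⟨hw, ht⟩)

lemma weight_ne_zero {w s : ℝ} (hw : 0 ≤ w) (hs : s ∈ atoms μ) (hs0 : 0 < s) (hws : w ≤ s) :
    weight μ w ≠ 0 := by
  intro h
  obtain ⟨h1, h2⟩ := add_eq_zero.1 h
  rcases hw.lt_or_eq with hpos | rfl
  · have hmem : s ∈ {t | 0 < w ∧ w ≤ t} := ⟨hpos, hws⟩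
    exact hs (measure_mono_null (Set.singleton_subset_iff.2 hmem) h1)
  · have hmem : s ∈ {t : ℝ | (0 : ℝ) ≤ 0 ∧ 0 < t} := ⟨le_rfl, hs0⟩
    exact hs (measure_mono_null (Set.singleton_subset_iff.2 hmem) h2)

lemma tsum_mul_measure_singleton_le [IsProbabilityMeasure μ] (c : ℝ) (V : ℝ → Set ℝ)
    (hV : MeasurableSet {p : ℝ × ℝ | p.2 ∈ V (p.1 + c)}) :
    ∑' w, μ (V w) * μ {w - c} ≤ μ.prod μ {p : ℝ × ℝ | p.2 ∈ V (p.1 + c)} := by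
  have hVw : ∀ w, MeasurableSet (V w) := fun w => by
    have := measurable_prodMk_left (x := w - c) hV
    simpa using this
  calc ∑' w, μ (V w) * μ {w - c}
      = ∑' w, μ.prod μ ({w - c} ×ˢ V w) := by
        refine tsum_congr fun w => ?_
        rw [Measure.prod_prod, mul_comm]
    _ ≤ μ.prod μ (⋃ w, {w - c} ×ˢ V w) := by
        refine tsum_meas_le_meas_iUnion_of_disjoint _
          (fun w => (measurableSet_singleton _).prod (hVw w)) ?_
        intro w w' hne
        rw [Function.onFun, Set.disjoint_prod]
        left
        simpa using hne
    _ ≤ _ := by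
        refine measure_mono (Set.iUnion_subset fun w => ?_)
        rintro ⟨s, t⟩ ⟨hs, ht⟩
        obtain rfl : s = w - c := hs
        simpa using ht

lemma prod_self_swap [IsProbabilityMeasure μ] {U : Set (ℝ × ℝ)} (hU : MeasurableSet U) :
    μ.prod μ {p | (p.2, p.1) ∈ U} = μ.prod μ U :=
  (Measure.measurePreserving_swap (μ := μ) (ν := μ)).measure_preimage hU.nullMeasurableSet

lemma prod_self_add_le [IsProbabilityMeasure μ] {U V : Set (ℝ × ℝ)} {W : Set ℝ}
    (hV : MeasurableSet V) (hUV : Disjoint U V)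
    (hW : ∀ᵐ p ∂μ.prod μ, p ∈ U ∪ V → p.1 ∈ W) :
    μ.prod μ U + μ.prod μ V ≤ μ W := by
  rw [← measure_union hUV hV]
  calc μ.prod μ (U ∪ V) ≤ μ.prod μ (W ×ˢ Set.univ) :=
        measure_mono_ae (hW.mono fun p hp h => ⟨hp h, trivial⟩)
    _ = μ W := by rw [Measure.prod_prod, measure_univ, mul_one]

/-- The weight is excessive for the reflected walk. With `s` the last increment and `t` an
independent copy, both sides are probabilities of events for `(s, t)`; exchanging `s` and `t` in the
terms coming from states above `y` turns the left side into that of a partition of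
`{s ≥ y}` and one of `{s > y}`. -/
lemma tsum_weight_mul_le [IsProbabilityMeasure μ] (hnn : ∀ᵐ s ∂μ, 0 ≤ s) (y : ℝ) :
    ∑' w, weight μ w * μ {s | |w - s| = y} ≤ weight μ y := by
  have hnn1 : ∀ᵐ p ∂μ.prod μ, 0 ≤ p.1 := Measure.quasiMeasurePreserving_fst.ae hnn
  have hnn2 : ∀ᵐ p ∂μ.prod μ, 0 ≤ p.2 := Measure.quasiMeasurePreserving_snd.ae hnn
  have hm1 : ∀ c : ℝ, MeasurableSet {p : ℝ × ℝ | 0 < p.1 + c ∧ p.1 + c ≤ p.2} := fun c => by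
    rw [Set.ofPred_and]
    exact (measurableSet_lt (by fun_prop) (by fun_prop)).inter
      (measurableSet_le (by fun_prop) (by fun_prop))
  have hm2 : ∀ c : ℝ, MeasurableSet {p : ℝ × ℝ | 0 ≤ p.1 + c ∧ p.1 + c < p.2} := fun c => by
    rw [Set.ofPred_and]
    exact (measurableSet_le (by fun_prop) (by fun_prop)).inter
      (measurableSet_lt (by fun_prop) (by fun_prop))
  have key : ∀ c : ℝ, ∑' w, weight μ w * μ {w - c} ≤
      μ.prod μ {p : ℝ × ℝ | 0 < p.1 + c ∧ p.1 + c ≤ p.2} +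
        μ.prod μ {p : ℝ × ℝ | 0 ≤ p.1 + c ∧ p.1 + c < p.2} := by
    intro c
    simp only [weight, add_mul]
    rw [ENNReal.tsum_add]
    exact add_le_add
      (tsum_mul_measure_singleton_le c (fun w => {t | 0 < w ∧ w ≤ t}) (hm1 c))
      (tsum_mul_measure_singleton_le c (fun w => {t | 0 ≤ w ∧ w < t}) (hm2 c))
  have swap1 : ∀ c : ℝ, μ.prod μ {p : ℝ × ℝ | 0 < p.2 + c ∧ p.2 + c ≤ p.1} =
      μ.prod μ {p : ℝ × ℝ | 0 < p.1 + c ∧ p.1 + c ≤ p.2} := fun c => prod_self_swap (hm1 c)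
  have swap2 : ∀ c : ℝ, μ.prod μ {p : ℝ × ℝ | 0 ≤ p.2 + c ∧ p.2 + c < p.1} =
      μ.prod μ {p : ℝ × ℝ | 0 ≤ p.1 + c ∧ p.1 + c < p.2} := fun c => prod_self_swap (hm2 c)
  rcases lt_trichotomy y 0 with hy | rfl | hy
  · have h0 : ∀ w : ℝ, {s : ℝ | |w - s| = y} = ∅ := fun w =>
      Set.eq_empty_of_forall_notMem fun s (hs : |w - s| = y) =>
        absurd (abs_nonneg (w - s)) (by rw [hs]; exact not_le.2 hy)
    simp [h0]
  · have h0 : ∀ w : ℝ, {s : ℝ | |w - s| = 0} = {w - 0} := fun w => by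
      ext s
      simp [sub_eq_zero, eq_comm]
    simp only [h0]
    refine (key 0).trans ?_
    rw [← swap2 0]
    refine (prod_self_add_le (W := {t | (0 : ℝ) ≤ 0 ∧ 0 < t}) ?_ ?_ ?_).trans le_add_self
    · rw [Set.ofPred_and]
      exact (measurableSet_le (by fun_prop) (by fun_prop)).inter
        (measurableSet_lt (by fun_prop) (by fun_prop))
    · rw [Set.disjoint_left]
      rintro p ⟨-, h1⟩ ⟨-, h2⟩
      linarith
    · filter_upwards with p hp
      refine ⟨le_rfl, ?_⟩
      rcases hp with ⟨h, -⟩ | ⟨h, h'⟩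
      · linarith
      · linarith
  · have hsplit : ∀ w : ℝ, μ {s | |w - s| = y} ≤ μ {w - y} + μ {w - -y} := fun w => by
      refine (measure_mono ?_).trans (measure_union_le _ _)
      intro s (hs : |w - s| = y)
      rcases abs_choice (w - s) with h | h
      · left
        rw [Set.mem_singleton_iff]
        linarith
      · right
        rw [Set.mem_singleton_iff]
        linarith
    calc ∑' w, weight μ w * μ {s | |w - s| = y}
        ≤ ∑' w, (weight μ w * μ {w - y} + weight μ w * μ {w - -y}) := by
          refine ENNReal.tsum_le_tsum fun w => ?_
          rw [← mul_add]
          gcongr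
          exact hsplit w
      _ ≤ (μ.prod μ {p : ℝ × ℝ | 0 < p.2 + y ∧ p.2 + y ≤ p.1} +
            μ.prod μ {p : ℝ × ℝ | 0 ≤ p.2 + y ∧ p.2 + y < p.1}) +
          (μ.prod μ {p : ℝ × ℝ | 0 < p.1 + -y ∧ p.1 + -y ≤ p.2} +
            μ.prod μ {p : ℝ × ℝ | 0 ≤ p.1 + -y ∧ p.1 + -y < p.2}) := by
          rw [ENNReal.tsum_add, swap1, swap2]
          exact add_le_add (key y) (key (-y))
      _ = (μ.prod μ {p : ℝ × ℝ | 0 < p.2 + y ∧ p.2 + y ≤ p.1} +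
            μ.prod μ {p : ℝ × ℝ | 0 ≤ p.1 + -y ∧ p.1 + -y < p.2}) +
          (μ.prod μ {p : ℝ × ℝ | 0 ≤ p.2 + y ∧ p.2 + y < p.1} +
            μ.prod μ {p : ℝ × ℝ | 0 < p.1 + -y ∧ p.1 + -y ≤ p.2}) := by ring
      _ ≤ weight μ y := by
          refine add_le_add (prod_self_add_le (hm2 _) ?_ ?_) (prod_self_add_le (hm1 _) ?_ ?_)
          · rw [Set.disjoint_left]
            rintro p ⟨-, h1⟩ ⟨-, h2⟩
            linarith
          · filter_upwards [hnn2] with p hp2 hp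
            refine ⟨hy, ?_⟩
            rcases hp with ⟨-, h⟩ | ⟨h, -⟩ <;> linarith
          · rw [Set.disjoint_left]
            rintro p ⟨-, h1⟩ ⟨-, h2⟩
            linarith
          · filter_upwards [hnn2] with p hp2 hp
            refine ⟨hy.le, ?_⟩
            rcases hp with ⟨-, h⟩ | ⟨h, -⟩ <;> linarith

end Excessive

/-! ### Sums over a class of states -/

section Sums

variable {μ : Measure ℝ} {κ : ℝ}

lemma tsum_measure_Ici_eq [IsProbabilityMeasure μ] {d : ℝ} (hd : 0 < d) :
    ∑' k : ℕ, μ (Set.Ici (d * (k + 1))) = ∫⁻ t, (⌊t / d⌋₊ : ENNReal) ∂μ := by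
  have h : ∀ t : ℝ, (⌊t / d⌋₊ : ENNReal) =
      ∑' k : ℕ, (Set.Ici (d * ((k : ℝ) + 1))).indicator (fun _ => (1 : ENNReal)) t := by
    intro t
    rw [tsum_eq_sum (s := Finset.range ⌊t / d⌋₊)]
    · rw [Finset.sum_congr rfl (g := fun _ => (1 : ENNReal))]
      · simp
      · intro k hk
        refine Set.indicator_of_mem ?_ _
        have h1 : k + 1 ≤ ⌊t / d⌋₊ := Finset.mem_range.1 hk
        have h2 := (Nat.le_floor_iff' (Nat.succ_ne_zero k)).1 h1
        rw [le_div_iff₀ hd] at h2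
        push_cast at h2
        rw [Set.mem_Ici]
        linarith
    · intro k hk
      refine Set.indicator_of_notMem (fun h1 => hk ?_) _
      rw [Finset.mem_range]
      refine (Nat.le_floor_iff' (Nat.succ_ne_zero k)).2 ?_
      rw [le_div_iff₀ hd]
      push_cast
      rw [Set.mem_Ici] at h1
      linarith
  simp_rw [h]
  rw [lintegral_tsum fun k => (measurable_const.indicator measurableSet_Ici).aemeasurable]
  refine tsum_congr fun k => ?_
  rw [lintegral_indicator_const measurableSet_Ici, one_mul]

lemma tsum_measure_Ici_lt_top [IsProbabilityMeasure μ] (hκ : 0 < κ)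
    (hmean : ∫⁻ t, ENNReal.ofReal t ∂μ < ⊤) : ∑' k : ℕ, μ (Set.Ici (κ * k)) < ⊤ := by
  rw [tsum_eq_zero_add' ENNReal.summable]
  push_cast
  rw [tsum_measure_Ici_eq hκ]
  refine ENNReal.add_lt_top.2 ⟨measure_lt_top _ _, ?_⟩
  calc ∫⁻ t, (⌊t / κ⌋₊ : ENNReal) ∂μ ≤ ∫⁻ t, ENNReal.ofReal κ⁻¹ * ENNReal.ofReal t ∂μ := by
        refine lintegral_mono fun t => ?_
        rw [← ENNReal.ofReal_mul (by positivity), ← ENNReal.ofReal_natCast]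
        rcases le_total 0 t with ht | ht
        · refine ENNReal.ofReal_le_ofReal ((Nat.floor_le (by positivity)).trans_eq ?_)
          rw [div_eq_inv_mul]
        · rw [Nat.floor_of_nonpos (div_nonpos_of_nonpos_of_nonneg ht hκ.le)]
          simp
    _ = ENNReal.ofReal κ⁻¹ * ∫⁻ t, ENNReal.ofReal t ∂μ :=
        lintegral_const_mul _ ENNReal.measurable_ofReal
    _ < ⊤ := ENNReal.mul_lt_top ENNReal.ofReal_lt_top hmean

lemma tsum_measure_Ici_eq_top [IsProbabilityMeasure μ] {d : ℝ} (hd : 0 < d)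
    (hmean : ∫⁻ t, ENNReal.ofReal t ∂μ = ⊤) : ∑' k : ℕ, μ (Set.Ici (d * (k + 1))) = ⊤ := by
  rw [tsum_measure_Ici_eq hd]
  by_contra hne
  refine absurd hmean (ne_of_lt ?_)
  calc ∫⁻ t, ENNReal.ofReal t ∂μ
      ≤ ∫⁻ t, ENNReal.ofReal d * ((⌊t / d⌋₊ : ENNReal) + 1) ∂μ := by
        refine lintegral_mono fun t => ?_
        have h1 : (⌊t / d⌋₊ : ENNReal) + 1 = ENNReal.ofReal (⌊t / d⌋₊ + 1) := by
          rw [ENNReal.ofReal_add (by positivity) zero_le_one, ENNReal.ofReal_natCast,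
            ENNReal.ofReal_one]
        rw [h1, ← ENNReal.ofReal_mul hd.le]
        refine ENNReal.ofReal_le_ofReal ?_
        have := (Nat.lt_floor_add_one (t / d)).le
        rwa [div_le_iff₀' hd] at this
    _ = ENNReal.ofReal d * (∫⁻ t, (⌊t / d⌋₊ : ENNReal) ∂μ + 1) := by
        rw [lintegral_const_mul' _ _ ENNReal.ofReal_ne_top, lintegral_add_right _ measurable_const]
        simp
    _ < ⊤ := ENNReal.mul_lt_top ENNReal.ofReal_lt_top
        (ENNReal.add_lt_top.2 ⟨lt_top_iff_ne_top.2 hne, ENNReal.one_lt_top⟩)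

lemma tsum_measure_Ici_sq_lt_top [IsProbabilityMeasure μ]
    (hquad : Summable fun k : ℕ => (1 - cdf μ (κ * k)) ^ 2) (hκ : 0 < κ) :
    ∑' k : ℕ, μ (Set.Ici (κ * k)) ^ 2 < ⊤ := by
  rw [tsum_eq_zero_add' ENNReal.summable]
  refine ENNReal.add_lt_top.2 ⟨ENNReal.pow_lt_top (measure_lt_top _ _), ?_⟩
  calc ∑' k : ℕ, μ (Set.Ici (κ * ((k + 1 : ℕ) : ℝ))) ^ 2
      ≤ ∑' k : ℕ, ENNReal.ofReal ((1 - cdf μ (κ * k)) ^ 2) := by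
        refine ENNReal.tsum_le_tsum fun k => ?_
        have h1 : 1 - cdf μ (κ * k) = μ.real (Set.Ioi (κ * k)) := by
          rw [cdf_eq_real, ← Set.compl_Iic, probReal_compl_eq_one_sub measurableSet_Iic]
        rw [h1, ENNReal.ofReal_pow measureReal_nonneg, ofReal_measureReal]
        refine pow_le_pow_left' (measure_mono fun t ht => ?_) 2
        rw [Set.mem_Ici] at ht
        rw [Set.mem_Ioi]
        push_cast at ht
        nlinarith
    _ < ⊤ := hquad.tsum_ofReal_lt_top

/-- A class of states is contained in two arithmetic progressions with step at least `κ`. -/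
lemma tsum_indicator_essentialClass_le [IsProbabilityMeasure μ] (hκ : 0 < κ)
    (hlattice : ∀ᵐ y ∂μ, ∃ m : ℕ, y = κ * m) (hnondeg : μ ≠ Measure.dirac 0) (x₀ : ℝ)
    {f : ℝ → ENNReal} (hf : Antitone f) :
    ∑' y, (essentialClass μ x₀).indicator f y ≤ 2 * ∑' k : ℕ, f (κ * k) := by
  obtain ⟨hd, -, hκd⟩ := suppGcd_spec hκ hlattice hnondeg
  set d := suppGcd μ with hd_def
  have hprog : ∀ r : ℝ, 0 ≤ r →
      ∑' y : Set.range (fun k : ℕ => r + k * d), f y ≤ ∑' k : ℕ, f (κ * k) := by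
    intro r hr
    have hinj : Function.Injective fun k : ℕ => r + k * d := fun k k' h => by
      have : (k : ℝ) * d = k' * d := by simpa using h
      exact_mod_cast mul_right_cancel₀ hd.ne' this
    rw [tsum_range f hinj]
    refine ENNReal.tsum_le_tsum fun k => hf ?_
    have : (0 : ℝ) ≤ k := k.cast_nonneg
    nlinarith
  have hmem : ∀ a y : ℝ, 0 ≤ y → (∃ k : ℤ, y = k * d + a) →
      y ∈ Set.range fun k : ℕ => toIcoMod hd 0 a + k * d := by
    rintro a y hy ⟨k, rfl⟩
    have h1 := toIcoMod_add_toIcoDiv_zsmul hd 0 a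
    have h2 := toIcoMod_lt_right hd 0 a
    rw [zsmul_eq_mul] at h1
    have h3 : (0 : ℝ) < (k + toIcoDiv hd 0 a + 1 : ℤ) := by
      push_cast
      by_contra hneg
      nlinarith
    have h4 : 0 ≤ k + toIcoDiv hd 0 a := by
      have : 0 < k + toIcoDiv hd 0 a + 1 := by exact_mod_cast h3
      omega
    obtain ⟨m, hm⟩ := Int.eq_ofNat_of_zero_le h4
    refine ⟨m, ?_⟩
    have h5 : (m : ℝ) = k + toIcoDiv hd 0 a := by exact_mod_cast hm.symm
    simp only [h5]
    linarith
  rw [← tsum_subtype]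
  calc ∑' y : essentialClass μ x₀, f y
      ≤ ∑' y : ((Set.range fun k : ℕ => toIcoMod hd 0 x₀ + k * d) ∪
          (Set.range fun k : ℕ => toIcoMod hd 0 (-x₀) + k * d) : Set ℝ), f y := by
        refine ENNReal.tsum_mono_subtype f ?_
        rintro y ⟨⟨hy, k, h | h⟩, -⟩
        · exact Or.inl (hmem _ _ hy ⟨k, h⟩)
        · exact Or.inr (hmem _ _ hy ⟨k, by rw [h]; ring⟩)
    _ ≤ _ := ENNReal.tsum_union_le f _ _
    _ ≤ 2 * ∑' k : ℕ, f (κ * k) := by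
        rw [two_mul]
        exact add_le_add (hprog _ (left_le_toIcoMod _ _ _)) (hprog _ (left_le_toIcoMod _ _ _))

lemma tsum_weight_lt_top [IsProbabilityMeasure μ] (hκ : 0 < κ)
    (hlattice : ∀ᵐ y ∂μ, ∃ m : ℕ, y = κ * m) (hnondeg : μ ≠ Measure.dirac 0) (x₀ : ℝ)
    (hmean : ∫⁻ t, ENNReal.ofReal t ∂μ < ⊤) :
    ∑' y, (essentialClass μ x₀).indicator (weight μ) y < ⊤ := by
  have hanti : Antitone fun y : ℝ => 2 * μ (Set.Ici y) := fun a b hab => by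
    dsimp only
    gcongr
  calc ∑' y, (essentialClass μ x₀).indicator (weight μ) y
      ≤ ∑' y, (essentialClass μ x₀).indicator (fun y : ℝ => 2 * μ (Set.Ici y)) y :=
        ENNReal.tsum_le_tsum fun y => Set.indicator_le_indicator (weight_le y)
    _ ≤ 2 * ∑' k : ℕ, 2 * μ (Set.Ici (κ * k)) :=
        tsum_indicator_essentialClass_le hκ hlattice hnondeg x₀ hanti
    _ < ⊤ := by
        rw [ENNReal.tsum_mul_left]
        exact ENNReal.mul_lt_top (by simp)
          (ENNReal.mul_lt_top (by simp) (tsum_measure_Ici_lt_top hκ hmean))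

lemma tsum_weight_mul_measure_Ici_lt_top [IsProbabilityMeasure μ] (hκ : 0 < κ)
    (hlattice : ∀ᵐ y ∂μ, ∃ m : ℕ, y = κ * m) (hnondeg : μ ≠ Measure.dirac 0) (x₀ : ℝ)
    (hquad : Summable fun k : ℕ => (1 - cdf μ (κ * k)) ^ 2) :
    ∑' y, (essentialClass μ x₀).indicator (fun y => weight μ y * μ (Set.Ici y)) y < ⊤ := by
  have hanti : Antitone fun y : ℝ => 2 * μ (Set.Ici y) ^ 2 := fun a b hab => by
    dsimp only
    gcongr
  calc ∑' y, (essentialClass μ x₀).indicator (fun y => weight μ y * μ (Set.Ici y)) y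
      ≤ ∑' y, (essentialClass μ x₀).indicator (fun y : ℝ => 2 * μ (Set.Ici y) ^ 2) y := by
        refine ENNReal.tsum_le_tsum fun y => Set.indicator_le_indicator ?_
        rw [sq, ← mul_assoc]
        gcongr
        exact weight_le y
    _ ≤ 2 * ∑' k : ℕ, 2 * μ (Set.Ici (κ * k)) ^ 2 :=
        tsum_indicator_essentialClass_le hκ hlattice hnondeg x₀ hanti
    _ < ⊤ := by
        rw [ENNReal.tsum_mul_left]
        exact ENNReal.mul_lt_top (by simp)
          (ENNReal.mul_lt_top (by simp) (tsum_measure_Ici_sq_lt_top hquad hκ))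

lemma tsum_weight_eq_top [IsProbabilityMeasure μ] (hκ : 0 < κ)
    (hlattice : ∀ᵐ y ∂μ, ∃ m : ℕ, y = κ * m) (hnondeg : μ ≠ Measure.dirac 0) (x₀ : ℝ)
    (hmean : ∫⁻ t, ENNReal.ofReal t ∂μ = ⊤) :
    ∑' y, (essentialClass μ x₀).indicator (weight μ) y = ⊤ := by
  obtain ⟨hd, -, -⟩ := suppGcd_spec hκ hlattice hnondeg
  set d := suppGcd μ with hd_def
  -- An infinite mean forces unbounded increments, so that the class is not cut off above.
  have hunb : ∀ w : ℝ, ∃ s ∈ atoms μ, w ≤ s := by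
    by_contra! h
    obtain ⟨w, hw⟩ := h
    refine absurd hmean (ne_of_lt ?_)
    calc ∫⁻ t, ENNReal.ofReal t ∂μ ≤ ∫⁻ _, ENNReal.ofReal w ∂μ := by
          refine lintegral_mono_ae ?_
          filter_upwards [ae_mem_atoms hlattice] with t ht
            using ENNReal.ofReal_le_ofReal (hw t ht).le
      _ < ⊤ := by simp
  have hmod := toIocMod_mem_Ioc hd 0 x₀
  rw [zero_add] at hmod
  have hinj : Function.Injective fun k : ℕ => toIocMod hd 0 x₀ + k * d := fun k k' h => by
    have : (k : ℝ) * d = k' * d := by simpa using h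
    exact_mod_cast mul_right_cancel₀ hd.ne' this
  rw [eq_top_iff, ← tsum_measure_Ici_eq_top hd hmean]
  refine le_trans ?_ (ENNReal.tsum_comp_le_tsum_of_injective hinj _)
  refine ENNReal.tsum_le_tsum fun k => ?_
  have hk : (0 : ℝ) ≤ k * d := by positivity
  have hpos : 0 < toIocMod hd 0 x₀ + k * d := by linarith [hmod.1]
  rw [Set.indicator_of_mem]
  · refine le_trans (measure_mono (Set.Ici_subset_Ici.2 ?_)) (measure_Ici_le_weight hpos)
    linarith [hmod.2]
  · refine (mem_essentialClass_iff hκ hlattice).2 ⟨⟨hpos.le, k - toIocDiv hd 0 x₀, Or.inl ?_⟩,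
      hunb _⟩
    have := toIocMod_add_toIocDiv_zsmul hd 0 x₀
    rw [zsmul_eq_mul] at this
    push_cast
    linarith

end Sums

/-! ### The walk as a Markov chain -/

/-- The event that none of the first `n` moves of the walk started at `x` belongs to `K`. A move is
the pair of the position before it and the increment used. -/
def alive {Ω : Type*} (Y : ℕ → Ω → ℝ) (x : ℝ) (K : Set (ℝ × ℝ)) (n : ℕ) : Set Ω :=
  {ω | ∀ m < n, (walk Y x m ω, Y (m + 1) ω) ∉ K}

section Markov

variable {Ω : Type*} [MeasurableSpace Ω] {P : Measure Ω} {Y : ℕ → Ω → ℝ} {μ : Measure ℝ}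
  {κ x₀ x : ℝ} {K : Set (ℝ × ℝ)}

/-- The filtration generated by the increments. -/
abbrev past (hmeas : ∀ n, Measurable (Y n)) : Filtration ℕ ‹MeasurableSpace Ω› :=
  Filtration.natural Y fun n => (hmeas n).stronglyMeasurable

lemma measurable_walk_past (hmeas : ∀ n, Measurable (Y n)) (x : ℝ) (n : ℕ) :
    Measurable[past hmeas n] (walk Y x n) := by
  induction n with
  | zero => exact measurable_const
  | succ n ih =>
    have h1 := ih.mono ((past hmeas).mono n.le_succ) le_rfl
    have h2 := (Filtration.stronglyAdapted_natural
      fun n => (hmeas n).stronglyMeasurable) (n + 1)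
    exact measurable_norm.comp (h1.sub h2.measurable)

lemma measurable_walk (hmeas : ∀ n, Measurable (Y n)) (x : ℝ) (n : ℕ) :
    Measurable (walk Y x n) :=
  (measurable_walk_past hmeas x n).mono (Filtration.le _ n) le_rfl

lemma measurableSet_alive_past (hmeas : ∀ n, Measurable (Y n)) (x : ℝ) (hK : MeasurableSet K)
    (n : ℕ) :
    MeasurableSet[past hmeas n] (alive Y x K n) := by
  have h : alive Y x K n = ⋂ m, ⋂ (_ : m < n), {ω | (walk Y x m ω, Y (m + 1) ω) ∉ K} := by
    ext ω
    simp [alive]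
  rw [h]
  refine MeasurableSet.iInter fun m => MeasurableSet.iInter fun hm => ?_
  have h1 := (measurable_walk_past hmeas x m).mono
    ((past hmeas).mono hm.le) le_rfl
  have h2 := ((Filtration.stronglyAdapted_natural
    fun n => (hmeas n).stronglyMeasurable) (m + 1)).measurable.mono
    ((past hmeas).mono (Nat.succ_le_of_lt hm))
    le_rfl
  exact (h1.prodMk h2) hK.compl

lemma measurableSet_alive (hmeas : ∀ n, Measurable (Y n)) (x : ℝ) (hK : MeasurableSet K) (n : ℕ) :
    MeasurableSet (alive Y x K n) :=
  Filtration.le _ n _ (measurableSet_alive_past hmeas x hK n)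

lemma measure_inter_increment (hmeas : ∀ n, Measurable (Y n)) (hindep : iIndepFun Y P)
    (hlaw : ∀ n, P.map (Y n) = μ) {n : ℕ} {A : Set Ω}
    (hA : MeasurableSet[past hmeas n] A)
    {S : Set ℝ} (hS : MeasurableSet S) : P (A ∩ Y (n + 1) ⁻¹' S) = P A * μ S := by
  have h := hindep.indep_comap_natural_of_lt (fun n => (hmeas n).stronglyMeasurable) n.lt_succ_self
  rw [Set.inter_comm, mul_comm, ← hlaw (n + 1), Measure.map_apply (hmeas _) hS]
  exact (Indep_iff _ _ _).1 h _ _ ⟨S, hS, rfl⟩ hA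

lemma measure_le_tsum_fiber {D : Set ℝ} (hD : D.Countable) {X : Ω → ℝ}
    (hX : ∀ᵐ ω ∂P, X ω ∈ D) (E : Set Ω) : P E ≤ ∑' w, P (E ∩ {ω | X ω = w}) := by
  have := hD.to_subtype
  calc P E ≤ P (⋃ w : D, E ∩ {ω | X ω = w}) := by
        refine measure_mono_ae ?_
        filter_upwards [hX] with ω hω hE
        exact Set.mem_iUnion.2 ⟨⟨X ω, hω⟩, hE, rfl⟩
    _ ≤ ∑' w : D, P (E ∩ {ω | X ω = w}) := measure_iUnion_le _
    _ ≤ ∑' w, P (E ∩ {ω | X ω = w}) :=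
        ENNReal.tsum_comp_le_tsum_of_injective Subtype.val_injective fun w => P (E ∩ {ω | X ω = w})

lemma tsum_fiber_le {X : Ω → ℝ} (hX : Measurable X) {E : Set Ω} (hE : MeasurableSet E) :
    ∑' w, P (E ∩ {ω | X ω = w}) ≤ P E := by
  refine (tsum_meas_le_meas_iUnion_of_disjoint P
    (fun w => hE.inter (hX (measurableSet_singleton w))) ?_).trans
    (measure_mono (Set.iUnion_subset fun w => Set.inter_subset_left))
  intro w w' hne
  rw [Function.onFun, Set.disjoint_left]
  rintro ω ⟨-, h⟩ ⟨-, h'⟩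
  exact hne (Eq.trans (Eq.symm h) h')

lemma ae_mem_atoms_increments (hmeas : ∀ n, Measurable (Y n)) (hlaw : ∀ n, P.map (Y n) = μ)
    (hlattice : ∀ᵐ y ∂μ, ∃ m : ℕ, y = κ * m) : ∀ᵐ ω ∂P, ∀ n, Y n ω ∈ atoms μ := by
  refine ae_all_iff.2 fun n => ?_
  have h := ae_mem_atoms hlattice
  rw [← hlaw n] at h
  have h' := ae_of_ae_map (hmeas n).aemeasurable h
  rwa [hlaw n] at h'

lemma ae_walk_mem_essentialClass [IsProbabilityMeasure μ] (hmeas : ∀ n, Measurable (Y n))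
    (hlaw : ∀ n, P.map (Y n) = μ) (hκ : 0 < κ)
    (hlattice : ∀ᵐ y ∂μ, ∃ m : ℕ, y = κ * m) (hnondeg : μ ≠ Measure.dirac 0)
    (hx : x ∈ essentialClass μ x₀) : ∀ᵐ ω ∂P, ∀ n, walk Y x n ω ∈ essentialClass μ x₀ := by
  filter_upwards [ae_mem_atoms_increments hmeas hlaw hlattice] with ω hω n
  induction n with
  | zero => exact hx
  | succ n ih => exact step_mem_essentialClass hκ hlattice hnondeg ih (hω (n + 1))

/-- The Markov property, for a past event `A` and a move in `B`. -/
lemma measure_inter_move_le (hmeas : ∀ n, Measurable (Y n)) (hindep : iIndepFun Y P)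
    (hlaw : ∀ n, P.map (Y n) = μ) {D : Set ℝ} (hD : D.Countable) {n : ℕ}
    (hwalk : ∀ᵐ ω ∂P, walk Y x n ω ∈ D) {A : Set Ω}
    (hA : MeasurableSet[past hmeas n] A)
    {B : Set (ℝ × ℝ)} (hB : MeasurableSet B) :
    P (A ∩ {ω | (walk Y x n ω, Y (n + 1) ω) ∈ B}) ≤
      ∑' w, P (A ∩ {ω | walk Y x n ω = w}) * μ {s | (w, s) ∈ B} := by
  refine (measure_le_tsum_fiber hD hwalk _).trans (ENNReal.tsum_le_tsum fun w => ?_)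
  have hAw : MeasurableSet[past hmeas n] (A ∩ {ω | walk Y x n ω = w}) :=
    MeasurableSet.inter hA (measurable_walk_past hmeas x n (measurableSet_singleton w))
  refine le_of_le_of_eq (measure_mono ?_)
    (measure_inter_increment hmeas hindep hlaw hAw (measurable_prodMk_left hB))
  rintro ω ⟨⟨h1, h2⟩, h3⟩
  have h3' : walk Y x n ω = w := h3
  refine ⟨⟨h1, h3⟩, ?_⟩
  have h2' : (walk Y x n ω, Y (n + 1) ω) ∈ B := h2
  rwa [h3'] at h2'

lemma exists_pos_of_reach [IsProbabilityMeasure P] (hmeas : ∀ n, Measurable (Y n))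
    (hindep : iIndepFun Y P) (hlaw : ∀ n, P.map (Y n) = μ) {y : ℝ} (h : Reach (atoms μ) x y) :
    ∃ n, P {ω | walk Y x n ω = y} ≠ 0 := by
  induction h with
  | refl => exact ⟨0, by simp [walk]⟩
  | @tail b c _ hbc ih =>
    obtain ⟨s, hs, rfl⟩ := hbc
    obtain ⟨n, hn⟩ := ih
    refine ⟨n + 1, fun h0 => ?_⟩
    have h1 := measure_inter_increment hmeas hindep hlaw (n := n)
      (measurable_walk_past hmeas x n (measurableSet_singleton b)) (measurableSet_singleton s)
    refine mul_ne_zero hn hs (h1.symm.trans (measure_mono_null ?_ h0))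
    rintro ω ⟨hω, hω'⟩
    obtain rfl : walk Y x n ω = b := hω
    obtain rfl : Y (n + 1) ω = s := hω'
    rfl

/-- Comparison of occupation measures with an excessive measure. If the weight dominates its image
under the moves outside `K` together with a mass `c` at `x`, then it dominates `c` times the
expected number of visits to each state before the first move in `K`. -/
lemma mul_tsum_alive_le [IsProbabilityMeasure P] [IsProbabilityMeasure μ]
    (hmeas : ∀ n, Measurable (Y n))
    (hindep : iIndepFun Y P) (hlaw : ∀ n, P.map (Y n) = μ) {D : Set ℝ} (hD : D.Countable)
    (hwalk : ∀ᵐ ω ∂P, ∀ n, walk Y x n ω ∈ D) (hK : MeasurableSet K) {c : ENNReal}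
    (hc : ∀ y, ∑' w, weight μ w * μ {s | |w - s| = y ∧ (w, s) ∉ K} +
      c * Set.indicator {x} (fun _ => 1) y ≤ weight μ y) (y : ℝ) :
    c * ∑' n, P (alive Y x K n ∩ {ω | walk Y x n ω = y}) ≤ weight μ y := by
  have hstep : ∀ n y, P (alive Y x K (n + 1) ∩ {ω | walk Y x (n + 1) ω = y}) ≤
      ∑' w, P (alive Y x K n ∩ {ω | walk Y x n ω = w}) *
        μ {s | |w - s| = y ∧ (w, s) ∉ K} := by
    intro n y
    have hB : MeasurableSet ({p : ℝ × ℝ | |p.1 - p.2| = y} ∩ Kᶜ) :=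
      (measurableSet_eq_fun (by fun_prop) (by fun_prop)).inter hK.compl
    refine le_trans (measure_mono ?_) (measure_inter_move_le hmeas hindep hlaw hD
      (ae_all_iff.1 hwalk n) (measurableSet_alive_past hmeas x hK n) hB)
    rintro ω ⟨h1, h2⟩
    exact ⟨fun m hm => h1 m (hm.trans n.lt_succ_self), h2, h1 n n.lt_succ_self⟩
  have hpart : ∀ m y, c * ∑ n ∈ Finset.range m,
      P (alive Y x K n ∩ {ω | walk Y x n ω = y}) ≤ weight μ y := by
    intro m
    induction m with
    | zero => intro y; simp
    | succ m ih =>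
      intro y
      rw [Finset.sum_range_succ', mul_add]
      refine le_trans (add_le_add ?_ ?_) (hc y)
      · calc c * ∑ n ∈ Finset.range m, P (alive Y x K (n + 1) ∩ {ω | walk Y x (n + 1) ω = y})
            ≤ c * ∑ n ∈ Finset.range m, ∑' w, P (alive Y x K n ∩ {ω | walk Y x n ω = w}) *
              μ {s | |w - s| = y ∧ (w, s) ∉ K} := by
              gcongr with n
              exact hstep n y
          _ = ∑' w, (c * ∑ n ∈ Finset.range m, P (alive Y x K n ∩ {ω | walk Y x n ω = w})) *
              μ {s | |w - s| = y ∧ (w, s) ∉ K} := by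
              rw [← Summable.tsum_finsetSum fun _ _ => ENNReal.summable, ← ENNReal.tsum_mul_left]
              simp_rw [mul_assoc, Finset.sum_mul]
          _ ≤ _ := ENNReal.tsum_le_tsum fun w => by
              gcongr
              exact ih w
      · gcongr
        by_cases hy : y = x
        · rw [Set.indicator_of_mem (by simpa using hy)]
          exact prob_le_one
        · refine le_of_eq_of_le ?_ zero_le
          refine measure_mono_null ?_ measure_empty
          rintro ω ⟨-, h⟩
          exact hy (Eq.symm h)
  rw [ENNReal.tsum_eq_iSup_nat, ENNReal.mul_iSup]
  exact iSup_le fun m => hpart m y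

end Markov

section Moves

variable {μ : Measure ℝ} {x : ℝ}

/-- The moves that lead to `x`. -/
def hitMoves (x : ℝ) : Set (ℝ × ℝ) := {p | |p.1 - p.2| = x}

/-- The moves that lead to `x` by a reflection. -/
def reflectMoves (x : ℝ) : Set (ℝ × ℝ) := {p | |p.1 - p.2| = x} ∩ {p | p.1 ≤ p.2}

lemma measurableSet_hitMoves (x : ℝ) : MeasurableSet (hitMoves x) :=
  measurableSet_eq_fun (by fun_prop) (by fun_prop)

lemma measurableSet_reflectMoves (x : ℝ) : MeasurableSet (reflectMoves x) :=
  (measurableSet_eq_fun (by fun_prop) (by fun_prop)).inter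
    (measurableSet_le (by fun_prop) (by fun_prop))

lemma weight_hitMoves [IsProbabilityMeasure μ] (hnn : ∀ᵐ s ∂μ, 0 ≤ s) (y : ℝ) :
    ∑' w, weight μ w * μ {s | |w - s| = y ∧ (w, s) ∉ hitMoves x} +
      weight μ x * Set.indicator {x} (fun _ => 1) y ≤ weight μ y := by
  by_cases hy : y = x
  · subst hy
    have h0 : ∀ w : ℝ, {s : ℝ | |w - s| = y ∧ (w, s) ∉ hitMoves y} = ∅ := fun w =>
      Set.eq_empty_of_forall_notMem fun s hs => hs.2 hs.1
    simp [h0]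
  · rw [Set.indicator_of_notMem (by simpa using hy), mul_zero, add_zero]
    refine le_trans (ENNReal.tsum_le_tsum fun w => ?_) (tsum_weight_mul_le hnn y)
    gcongr
    exact fun hs => hs.1

lemma weight_reflectMoves [IsProbabilityMeasure μ] (hnn : ∀ᵐ s ∂μ, 0 ≤ s) (hx : 0 ≤ x) (y : ℝ) :
    ∑' w, weight μ w * μ {s | |w - s| = y ∧ (w, s) ∉ reflectMoves x} +
      (∑' w, weight μ w * μ {w + x}) * Set.indicator {x} (fun _ => 1) y ≤ weight μ y := by
  refine le_trans ?_ (tsum_weight_mul_le hnn y)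
  by_cases hy : y = x
  · subst hy
    rw [Set.indicator_of_mem (Set.mem_singleton y), mul_one, ← ENNReal.tsum_add]
    refine ENNReal.tsum_le_tsum fun w => ?_
    rw [← mul_add]
    gcongr
    rw [← measure_union _ (measurableSet_singleton _)]
    · refine measure_mono (Set.union_subset (fun s hs => hs.1) ?_)
      rintro _ rfl
      change |w - (w + y)| = y
      rw [sub_add_cancel_left, abs_neg, abs_of_nonneg hx]
    · rw [Set.disjoint_singleton_right]
      rintro ⟨h, h'⟩
      exact h' ⟨h, le_add_of_nonneg_right hx⟩
  · rw [Set.indicator_of_notMem (by simpa using hy), mul_zero, add_zero]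
    refine ENNReal.tsum_le_tsum fun w => ?_
    gcongr
    exact fun hs => hs.1

end Moves

/-! ### Return times and reflection times along a path -/

section Path

lemma tsum_indicator_lt (t : ℕ∞) :
    ∑' n : ℕ, {n : ℕ | (n : ℕ∞) < t}.indicator (fun _ => (1 : ENNReal)) n = t := by
  induction t using ENat.recTopCoe with
  | top => simp
  | coe t =>
    rw [tsum_eq_sum (s := Finset.range t)]
    · rw [Finset.sum_congr rfl (g := fun _ => (1 : ENNReal))]
      · simp
      · intro n hn
        refine Set.indicator_of_mem ?_ _
        simpa using hn
    · intro n hn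
      refine Set.indicator_of_notMem ?_ _
      simpa using hn

lemma exists_eq_of_sInf_lt_top {U : Set ℕ} (h : sInf ((fun n : ℕ => (n : ℕ∞)) '' U) < ⊤) :
    ∃ n ∈ U, sInf ((fun n : ℕ => (n : ℕ∞)) '' U) = n := by
  have hne : ((fun n : ℕ => (n : ℕ∞)) '' U).Nonempty := by
    by_contra hempty
    rw [Set.not_nonempty_iff_eq_empty.1 hempty, sInf_empty] at h
    exact lt_irrefl _ h
  obtain ⟨n, hn, h'⟩ := csInf_mem hne
  exact ⟨n, hn, h'.symm⟩

variable {Ω : Type*} {Y : ℕ → Ω → ℝ} {x : ℝ} {ω : Ω}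

lemma returnTime_le {S : Type*} {Z : S → ℕ → Ω → WithTop S} {x : S} {n : ℕ} (hn : 1 ≤ n)
    (h : Z x n ω = (x : WithTop S)) : returnTime Z x ω ≤ n :=
  sInf_le ⟨n, ⟨hn, h⟩, rfl⟩

lemma exists_of_returnTime_lt_top {S : Type*} {Z : S → ℕ → Ω → WithTop S} {x : S}
    (h : returnTime Z x ω < ⊤) :
    ∃ n : ℕ, (1 ≤ n ∧ Z x n ω = (x : WithTop S)) ∧ returnTime Z x ω = n :=
  exists_eq_of_sInf_lt_top h

lemma mem_alive_hitMoves_iff {n : ℕ} :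
    ω ∈ alive Y x (hitMoves x) n ↔ (n : ℕ∞) < returnTime (walkChain Y) x ω := by
  constructor
  · intro h
    by_contra! hle
    obtain ⟨t, ⟨ht1, ht⟩, hteq⟩ := exists_of_returnTime_lt_top
      (hle.trans_lt (ENat.natCast_lt_top n))
    rw [hteq, Nat.cast_le] at hle
    obtain ⟨m, rfl⟩ := Nat.exists_eq_add_of_le' ht1
    exact h m hle (WithTop.coe_injective ht)
  · intro h m hm hmem
    have hret : walkChain Y x (m + 1) ω = (x : WithTop ℝ) := congrArg _ hmem
    have h1 := h.trans_le (returnTime_le (Nat.le_add_left 1 m) hret)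
    rw [Nat.cast_lt] at h1
    omega

lemma tsum_indicator_alive (Y : ℕ → Ω → ℝ) (x : ℝ) (ω : Ω) :
    ∑' n, (alive Y x (hitMoves x) n).indicator (fun _ => (1 : ENNReal)) ω =
      returnTime (walkChain Y) x ω := by
  rw [← tsum_indicator_lt]
  refine tsum_congr fun n => ?_
  have hiff : n ∈ {n : ℕ | (n : ℕ∞) < returnTime (walkChain Y) x ω} ↔
      ω ∈ alive Y x (hitMoves x) n := mem_alive_hitMoves_iff.symm
  by_cases h : ω ∈ alive Y x (hitMoves x) n
  · rw [Set.indicator_of_mem h, Set.indicator_of_mem (hiff.2 h)]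
  · rw [Set.indicator_of_notMem h, Set.indicator_of_notMem fun h' => h (hiff.1 h')]

lemma walk_succ_eq_neg_iff {m : ℕ} :
    walk Y x (m + 1) ω = -(walk Y x (m + 1 - 1) ω - Y (m + 1) ω) ↔
      walk Y x m ω ≤ Y (m + 1) ω := by
  change |walk Y x m ω - Y (m + 1) ω| = -(walk Y x m ω - Y (m + 1) ω) ↔ _
  rw [abs_eq_neg_self, sub_nonpos]

/-- A reflection time after the `k`-th one, in terms of the move that ends there. -/
lemma exists_move_of_reflectionTime_lt_top {k : ℕ} (h : reflectionTime Y x (k + 1) ω < ⊤) :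
    ∃ m : ℕ, reflectionTime Y x (k + 1) ω = (m + 1 : ℕ) ∧
      reflectionTime Y x k ω < (m + 1 : ℕ) ∧ walk Y x m ω ≤ Y (m + 1) ω := by
  obtain ⟨n, ⟨hn1, hn2⟩, hn⟩ := exists_eq_of_sInf_lt_top h
  have hpos : 0 < n := by
    rw [← Nat.cast_pos (α := ℕ∞)]
    exact lt_of_le_of_lt zero_le hn1
  obtain ⟨m, rfl⟩ := Nat.exists_eq_add_of_le' hpos
  exact ⟨m, hn, hn1, walk_succ_eq_neg_iff.1 hn2⟩

lemma reflectionTime_succ_le {k m : ℕ} (h : reflectionTime Y x k ω < (m + 1 : ℕ))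
    (hm : walk Y x m ω ≤ Y (m + 1) ω) : reflectionTime Y x (k + 1) ω ≤ (m + 1 : ℕ) :=
  sInf_le ⟨m + 1, ⟨h, walk_succ_eq_neg_iff.2 hm⟩, rfl⟩

lemma reflectionTime_monotone (Y : ℕ → Ω → ℝ) (x : ℝ) (ω : Ω) :
    Monotone fun k => reflectionTime Y x k ω := by
  refine monotone_nat_of_le_succ fun k => ?_
  rcases eq_or_ne (reflectionTime Y x (k + 1) ω) ⊤ with h | h
  · simp [h]
  · obtain ⟨m, hm, hlt, -⟩ := exists_move_of_reflectionTime_lt_top (lt_top_iff_ne_top.2 h)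
    exact hlt.le.trans_eq hm.symm

lemma reflectionTime_lt_succ {k : ℕ} (h : reflectionTime Y x (k + 1) ω < ⊤) :
    reflectionTime Y x k ω < reflectionTime Y x (k + 1) ω := by
  obtain ⟨m, hm, hlt, -⟩ := exists_move_of_reflectionTime_lt_top h
  rwa [hm]

lemma le_reflectionTime (Y : ℕ → Ω → ℝ) (x : ℝ) (ω : Ω) (k : ℕ) :
    (k : ℕ∞) ≤ reflectionTime Y x k ω := by
  induction k with
  | zero => simp
  | succ k ih =>
    rcases eq_or_ne (reflectionTime Y x (k + 1) ω) ⊤ with h | h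
    · simp [h]
    · rw [Nat.cast_succ]
      exact Order.add_one_le_of_lt (ih.trans_lt (reflectionTime_lt_succ (lt_top_iff_ne_top.2 h)))

/-- Every reflection is counted by some reflection time. -/
lemma exists_reflectionTime_eq {m : ℕ} (hm : walk Y x m ω ≤ Y (m + 1) ω) :
    ∃ k : ℕ, 1 ≤ k ∧ reflectionTime Y x k ω = (m + 1 : ℕ) := by
  by_contra! h
  have hlt : ∀ k : ℕ, reflectionTime Y x k ω < (m + 1 : ℕ) := by
    intro k
    induction k with
    | zero => exact Nat.cast_pos.2 m.succ_pos
    | succ k ih => exact (reflectionTime_succ_le ih hm).lt_of_ne (h (k + 1) (Nat.le_add_left 1 k))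
  exact lt_irrefl _ ((le_reflectionTime Y x ω (m + 1)).trans_lt (hlt (m + 1)))

lemma reflectionTime_lt_top (hinf : ∀ N : ℕ, ∃ m, N ≤ m ∧ walk Y x m ω ≤ Y (m + 1) ω) (k : ℕ) :
    reflectionTime Y x k ω < ⊤ := by
  induction k with
  | zero => exact ENat.natCast_lt_top 0
  | succ k ih =>
    obtain ⟨N, hN⟩ := ENat.ne_top_iff_exists.1 ih.ne
    obtain ⟨m, hNm, hm⟩ := hinf N
    refine (reflectionTime_succ_le ?_ hm).trans_lt (ENat.natCast_lt_top _)
    rw [← hN, Nat.cast_lt]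
    omega

lemma reflectionChain_eq_iff {k : ℕ} {y : ℝ} :
    reflectionChain Y x k ω = (y : WithTop ℝ) ↔
      ∃ n : ℕ, reflectionTime Y x k ω = n ∧ walk Y x n ω = y := by
  rw [reflectionChain]
  induction reflectionTime Y x k ω using ENat.recTopCoe with
  | top => simp
  | coe n => simp

/-- The number of reflections up to the return to `x` by a reflection is at most the number of
reflecting moves made before that return. -/
lemma returnTime_reflectionChain_le
    (hinf : ∀ N : ℕ, ∃ m, N ≤ m ∧ walk Y x m ω ≤ Y (m + 1) ω) :
    (returnTime (reflectionChain Y) x ω : ENNReal) ≤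
      ∑' n, (alive Y x (reflectMoves x) n ∩
        {ω | walk Y x n ω ≤ Y (n + 1) ω}).indicator (fun _ => (1 : ENNReal)) ω := by
  choose f hf using fun j : ℕ =>
    exists_move_of_reflectionTime_lt_top (reflectionTime_lt_top hinf (j + 1))
  have hmono : StrictMono f := by
    refine strictMono_nat_of_lt_succ fun j => ?_
    have h := reflectionTime_lt_succ (reflectionTime_lt_top hinf (j + 1 + 1))
    rw [(hf j).1, (hf (j + 1)).1, Nat.cast_lt] at h
    omega
  rw [← tsum_indicator_lt]
  refine le_trans (ENNReal.tsum_le_tsum fun j => ?_)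
    (ENNReal.tsum_comp_le_tsum_of_injective hmono.injective _)
  by_cases hj : j ∈ {n : ℕ | (n : ℕ∞) < returnTime (reflectionChain Y) x ω}
  · rw [Set.indicator_of_mem hj, Set.indicator_of_mem]
    refine ⟨fun m hm hmem => ?_, (hf j).2.2⟩
    -- A reflection at `x` before the move `f j` would be the return of the chain, too early.
    obtain ⟨i, hi1, hi⟩ := exists_reflectionTime_eq (Y := Y) (x := x) hmem.2
    have hij : i < j + 1 := by
      by_contra! hle
      have h := reflectionTime_monotone Y x ω hle
      simp only [hi, (hf j).1, Nat.cast_le] at h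
      omega
    have hret := returnTime_le (Z := reflectionChain Y) hi1
      (reflectionChain_eq_iff.2 ⟨m + 1, hi, hmem.1⟩)
    have hlt : (j : ℕ∞) < i := lt_of_lt_of_le hj hret
    rw [Nat.cast_lt] at hlt
    omega
  · rw [Set.indicator_of_notMem hj]
    exact zero_le

end Path

section Infinite

variable {Ω : Type*} [MeasurableSpace Ω] {P : Measure Ω} {Y : ℕ → Ω → ℝ} {μ : Measure ℝ} {κ : ℝ}

/-- Almost surely, from every starting point, the walk is reflected infinitely often: a positive
increment occurs infinitely often, so that the walk cannot decrease forever. -/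
lemma ae_infinitely_many_reflections [IsProbabilityMeasure P] [IsProbabilityMeasure μ]
    (hmeas : ∀ n, Measurable (Y n)) (hindep : iIndepFun Y P) (hlaw : ∀ n, P.map (Y n) = μ)
    (hκ : 0 < κ) (hlattice : ∀ᵐ y ∂μ, ∃ m : ℕ, y = κ * m) (hnondeg : μ ≠ Measure.dirac 0) (x : ℝ)
    (hx : 0 ≤ x) :
    ∀ᵐ ω ∂P, ∀ N : ℕ, ∃ m, N ≤ m ∧ walk Y x m ω ≤ Y (m + 1) ω := by
  obtain ⟨s, hs, hs0⟩ := exists_pos_mem_atoms hκ hlattice hnondeg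
  have hms : ∀ n, MeasurableSet (Y n ⁻¹' {s}) := fun n => hmeas n (measurableSet_singleton s)
  have hind : iIndepSet (fun n => Y n ⁻¹' {s}) P :=
    (iIndepSet_iff_meas_biInter hms).2 fun S =>
      hindep.measure_inter_preimage_eq_mul S fun _ _ => measurableSet_singleton s
  have hsum : ∑' n, P (Y n ⁻¹' {s}) = ⊤ := by
    have h : ∀ n, P (Y n ⁻¹' {s}) = μ {s} := fun n => by
      rw [← hlaw n, Measure.map_apply (hmeas n) (measurableSet_singleton s)]
    simp_rw [h]
    exact ENNReal.tsum_const_eq_top_of_ne_zero hs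
  have hlim := measure_limsup_eq_one hms hind hsum
  have hae : ∀ᵐ ω ∂P, ω ∈ Filter.limsup (fun n => Y n ⁻¹' {s}) Filter.atTop := by
    rw [← prob_compl_eq_zero_iff (MeasurableSet.measurableSet_limsup hms)] at hlim
    exact hlim
  filter_upwards [hae, ae_mem_atoms_increments hmeas hlaw hlattice] with ω hω hY N
  rw [Filter.mem_limsup_iff_frequently_mem, Filter.frequently_atTop] at hω
  by_contra! hno
  have hstep : ∀ m, N ≤ m → walk Y x (m + 1) ω = walk Y x m ω - Y (m + 1) ω := fun m hm =>
    abs_of_nonneg (by linarith [hno m hm])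
  have hmono : ∀ m, N ≤ m → ∀ j, walk Y x (m + j) ω ≤ walk Y x m ω := by
    intro m hm j
    induction j with
    | zero => exact le_rfl
    | succ j ih =>
      have h1 := hstep (m + j) (by omega)
      have h2 := atoms_nonneg hκ hlattice (hY (m + j + 1))
      rw [← add_assoc, h1]
      linarith
  have hdrop : ∀ j : ℕ, ∃ m, N ≤ m ∧ walk Y x m ω ≤ walk Y x N ω - j * s := by
    intro j
    induction j with
    | zero => exact ⟨N, le_rfl, by simp⟩
    | succ j ih =>
      obtain ⟨m, hm, hle⟩ := ih
      obtain ⟨n, hn, hYn⟩ := hω (m + 1)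
      obtain ⟨i, rfl⟩ := Nat.exists_eq_add_of_le hn
      have h1 := hstep (m + i) (by omega)
      have h2 := hmono m hm i
      have h3 : Y (m + i + 1) ω = s := by
        rw [add_right_comm]
        exact hYn
      refine ⟨m + i + 1, by omega, ?_⟩
      rw [h1, h3]
      push_cast
      linarith
  obtain ⟨j, hj⟩ := exists_nat_gt (walk Y x N ω / s)
  rw [div_lt_iff₀ hs0] at hj
  obtain ⟨m, hm, hle⟩ := hdrop j
  have hnn : 0 ≤ walk Y x m ω := by
    cases m with
    | zero => exact hx
    | succ m => exact abs_nonneg _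
  linarith

end Infinite

/-! ### Essential classes of the two chains -/

section Recurrence

variable {Ω : Type*} [MeasurableSpace Ω] {P : Measure Ω} {Y : ℕ → Ω → ℝ} {μ : Measure ℝ}
  {κ x₀ x : ℝ}

lemma isEssentialClass_walkChain [IsProbabilityMeasure P] [IsProbabilityMeasure μ]
    (hmeas : ∀ n, Measurable (Y n)) (hindep : iIndepFun Y P)
    (hlaw : ∀ n, P.map (Y n) = μ) (hκ : 0 < κ) (hlattice : ∀ᵐ y ∂μ, ∃ m : ℕ, y = κ * m)
    (hnondeg : μ ≠ Measure.dirac 0) (x₀ : ℝ) :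
    IsEssentialClass P (walkChain Y) (essentialClass μ x₀) := by
  refine ⟨essentialClass_nonempty hκ hlattice hnondeg, fun x hx y => ⟨?_, fun hy => ?_⟩⟩
  · rintro ⟨n, hn⟩
    by_contra hy
    refine hn.ne' (measure_mono_null ?_
      (ae_iff.1 (ae_walk_mem_essentialClass hmeas hlaw hκ hlattice hnondeg hx)))
    intro ω hω hall
    obtain rfl : walk Y x n ω = y := WithTop.coe_injective hω
    exact hy (hall n)
  · obtain ⟨n, hn⟩ := exists_pos_of_reach hmeas hindep hlaw
      (reach_of_mem_essentialClass hκ hlattice hnondeg hx hy)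
    refine ⟨n, (pos_iff_ne_zero.2 hn).trans_le (measure_mono fun ω hω => ?_)⟩
    exact congrArg _ hω

lemma isEssentialClass_reflectionChain [IsProbabilityMeasure P] [IsProbabilityMeasure μ]
    (hmeas : ∀ n, Measurable (Y n)) (hindep : iIndepFun Y P)
    (hlaw : ∀ n, P.map (Y n) = μ) (hκ : 0 < κ) (hlattice : ∀ᵐ y ∂μ, ∃ m : ℕ, y = κ * m)
    (hnondeg : μ ≠ Measure.dirac 0) (x₀ : ℝ) :
    IsEssentialClass P (reflectionChain Y) (essentialClass μ x₀) := by
  refine ⟨essentialClass_nonempty hκ hlattice hnondeg, fun x hx y => ⟨?_, fun hy => ?_⟩⟩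
  · rintro ⟨k, hk⟩
    by_contra hy
    refine hk.ne' (measure_mono_null ?_
      (ae_iff.1 (ae_walk_mem_essentialClass hmeas hlaw hκ hlattice hnondeg hx)))
    intro ω hω hall
    obtain ⟨n, -, rfl⟩ := reflectionChain_eq_iff.1 hω
    exact hy (hall n)
  · -- A reflection with increment `N ≥ y` leads from `N - y` to `y`.
    obtain ⟨⟨hy0, -⟩, N, hN, hyN⟩ := (mem_essentialClass_iff hκ hlattice).1 hy
    have hz : N - y ∈ essentialClass μ x₀ := by
      have := step_mem_essentialClass hκ hlattice hnondeg hy hN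
      rwa [abs_of_nonpos (by linarith), neg_sub] at this
    obtain ⟨n, hn⟩ := exists_pos_of_reach hmeas hindep hlaw
      (reach_of_mem_essentialClass hκ hlattice hnondeg hx hz)
    by_contra! h
    have hnull : P (⋃ k, {ω | reflectionChain Y x k ω = (y : WithTop ℝ)}) = 0 :=
      measure_iUnion_null fun k => le_antisymm (h k) zero_le
    have h1 := measure_inter_increment hmeas hindep hlaw (n := n)
      (measurable_walk_past hmeas x n (measurableSet_singleton (N - y))) (measurableSet_singleton N)
    refine mul_ne_zero hn hN (h1.symm.trans (measure_mono_null ?_ hnull))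
    rintro ω ⟨hω, hω'⟩
    have hwalk : walk Y x n ω = N - y := hω
    have hinc : Y (n + 1) ω = N := hω'
    obtain ⟨k, -, hk⟩ := exists_reflectionTime_eq (Y := Y) (x := x) (ω := ω) (m := n)
      (by rw [hwalk, hinc]; linarith)
    refine Set.mem_iUnion.2 ⟨k, reflectionChain_eq_iff.2 ⟨n + 1, hk, ?_⟩⟩
    change |walk Y x n ω - Y (n + 1) ω| = y
    rw [hwalk, hinc, sub_sub_cancel_left, abs_neg, abs_of_nonneg hy0]

/-! ### Mean return times -/

lemma measure_inter_fiber_eq_zero [IsProbabilityMeasure μ]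
    (hmeas : ∀ n, Measurable (Y n)) (hlaw : ∀ n, P.map (Y n) = μ)
    (hκ : 0 < κ) (hlattice : ∀ᵐ y ∂μ, ∃ m : ℕ, y = κ * m) (hnondeg : μ ≠ Measure.dirac 0)
    (hx : x ∈ essentialClass μ x₀) (E : Set Ω) (n : ℕ) {w : ℝ} (hw : w ∉ essentialClass μ x₀) :
    P (E ∩ {ω | walk Y x n ω = w}) = 0 := by
  refine measure_mono_null ?_
    (ae_iff.1 (ae_walk_mem_essentialClass hmeas hlaw hκ hlattice hnondeg hx))
  rintro ω ⟨-, hω⟩ hall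
  obtain rfl : walk Y x n ω = w := hω
  exact hw (hall n)

lemma weight_ne_zero_of_mem [IsProbabilityMeasure μ]
    (hκ : 0 < κ) (hlattice : ∀ᵐ y ∂μ, ∃ m : ℕ, y = κ * m)
    (hnondeg : μ ≠ Measure.dirac 0) (hx : x ∈ essentialClass μ x₀) : weight μ x ≠ 0 := by
  obtain ⟨⟨hx0, -⟩, N, hN, hxN⟩ := (mem_essentialClass_iff hκ hlattice).1 hx
  obtain ⟨s, hs, hs0⟩ := exists_pos_mem_atoms hκ hlattice hnondeg
  rcases le_total x s with h | h
  · exact weight_ne_zero hx0 hs hs0 h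
  · exact weight_ne_zero hx0 hN (by linarith) hxN

/-- The weight sends positive mass to every state of the class by reflections. -/
lemma tsum_weight_reflect_ne_zero [IsProbabilityMeasure μ]
    (hκ : 0 < κ) (hlattice : ∀ᵐ y ∂μ, ∃ m : ℕ, y = κ * m)
    (hnondeg : μ ≠ Measure.dirac 0) (hx : x ∈ essentialClass μ x₀) :
    ∑' w, weight μ w * μ {w + x} ≠ 0 := by
  obtain ⟨-, N, hN, hxN⟩ := (mem_essentialClass_iff hκ hlattice).1 hx
  have hz : N - x ∈ essentialClass μ x₀ := by
    have := step_mem_essentialClass hκ hlattice hnondeg hx hN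
    rwa [abs_of_nonpos (by linarith), neg_sub] at this
  intro h
  refine mul_ne_zero (weight_ne_zero_of_mem hκ hlattice hnondeg hz) hN ?_
  have := ENNReal.tsum_eq_zero.1 h (N - x)
  rwa [sub_add_cancel] at this

/-- The reflection chain returns almost surely, in finite mean time. -/
lemma returnTime_reflectionChain_finite [IsProbabilityMeasure P] [IsProbabilityMeasure μ]
    (hmeas : ∀ n, Measurable (Y n)) (hindep : iIndepFun Y P)
    (hlaw : ∀ n, P.map (Y n) = μ) (hκ : 0 < κ) (hlattice : ∀ᵐ y ∂μ, ∃ m : ℕ, y = κ * m)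
    (hnondeg : μ ≠ Measure.dirac 0)
    (hquad : Summable fun k : ℕ => (1 - cdf μ (κ * k)) ^ 2) (hx : x ∈ essentialClass μ x₀) :
    IsRecurrentState P (reflectionChain Y) x ∧ meanReturnTime P (reflectionChain Y) x < ⊤ := by
  have hx0 : 0 ≤ x := hx.1.1
  have hwalk := ae_walk_mem_essentialClass (x := x) hmeas hlaw hκ hlattice hnondeg hx
  have hD := essentialClass_countable μ x₀
  have hKm := measurableSet_reflectMoves x
  set c := ∑' w, weight μ w * μ {w + x} with hc_def
  have hc0 : c ≠ 0 := tsum_weight_reflect_ne_zero hκ hlattice hnondeg hx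
  have hocc := mul_tsum_alive_le hmeas hindep hlaw hD hwalk hKm
    (weight_reflectMoves (ae_nonneg_of_lattice hκ hlattice) hx0)
  let E : ℕ → Set Ω := fun n => alive Y x (reflectMoves x) n ∩ {ω | walk Y x n ω ≤ Y (n + 1) ω}
  have hE : ∀ n, MeasurableSet (E n) := fun n =>
    (measurableSet_alive hmeas x hKm n).inter
      (measurableSet_le (measurable_walk hmeas x n) (hmeas (n + 1)))
  have hEmeas : ∀ n, Measurable ((E n).indicator fun _ => (1 : ENNReal)) := fun n =>
    measurable_const.indicator (hE n)
  have hint : ∫⁻ ω, ∑' n, (E n).indicator (fun _ => (1 : ENNReal)) ω ∂P = ∑' n, P (E n) := by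
    rw [lintegral_tsum fun n => (hEmeas n).aemeasurable]
    refine tsum_congr fun n => ?_
    rw [lintegral_indicator_const (hE n), one_mul]
  have hEle : ∀ n, P (E n) ≤
      ∑' w, P (alive Y x (reflectMoves x) n ∩ {ω | walk Y x n ω = w}) * μ (Set.Ici w) := fun n =>
    measure_inter_move_le hmeas hindep hlaw hD (ae_all_iff.1 hwalk n)
      (measurableSet_alive_past hmeas x hKm n) (B := {p : ℝ × ℝ | p.1 ≤ p.2})
      (measurableSet_le (by fun_prop) (by fun_prop))
  have hfin : ∑' n, P (E n) < ⊤ := by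
    have hmul : c * ∑' n, P (E n) < ⊤ := by
      calc c * ∑' n, P (E n)
          ≤ c * ∑' n, ∑' w, P (alive Y x (reflectMoves x) n ∩ {ω | walk Y x n ω = w}) *
              μ (Set.Ici w) := by
            gcongr with n
            exact hEle n
        _ = ∑' w, (c * ∑' n, P (alive Y x (reflectMoves x) n ∩ {ω | walk Y x n ω = w})) *
              μ (Set.Ici w) := by
            rw [ENNReal.tsum_comm, ← ENNReal.tsum_mul_left]
            simp_rw [mul_assoc, ENNReal.tsum_mul_right]
        _ ≤ ∑' w, (essentialClass μ x₀).indicator (fun y => weight μ y * μ (Set.Ici y)) w := by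
            refine ENNReal.tsum_le_tsum fun w => ?_
            by_cases hw : w ∈ essentialClass μ x₀
            · rw [Set.indicator_of_mem hw]
              gcongr
              exact hocc w
            · simp [measure_inter_fiber_eq_zero hmeas hlaw hκ hlattice hnondeg hx _ _ hw]
        _ < ⊤ := tsum_weight_mul_measure_Ici_lt_top hκ hlattice hnondeg x₀ hquad
    exact ENNReal.lt_top_of_mul_ne_top_right hmul.ne hc0
  have hle : ∀ᵐ ω ∂P, (returnTime (reflectionChain Y) x ω : ENNReal) ≤
      ∑' n, (E n).indicator (fun _ => (1 : ENNReal)) ω := by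
    filter_upwards [ae_infinitely_many_reflections hmeas hindep hlaw hκ hlattice hnondeg x hx0]
      with ω hω using returnTime_reflectionChain_le hω
  constructor
  · have hlt := ae_lt_top (Measurable.tsum hEmeas) (hint.trans_lt hfin).ne
    filter_upwards [hle, hlt] with ω h1 h2
    have h3 := h1.trans_lt h2
    rwa [← ENat.toENNReal_top, ENat.toENNReal_lt] at h3
  · exact (lintegral_mono_ae hle).trans_lt (hint.trans_lt hfin)

lemma meanReturnTime_walkChain_eq (hmeas : ∀ n, Measurable (Y n)) (x : ℝ) :
    meanReturnTime P (walkChain Y) x = ∑' n, P (alive Y x (hitMoves x) n) := by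
  have hA := measurableSet_alive hmeas x (measurableSet_hitMoves x)
  simp_rw [meanReturnTime, ← tsum_indicator_alive]
  rw [lintegral_tsum fun n => (measurable_const.indicator (hA n)).aemeasurable]
  refine tsum_congr fun n => ?_
  rw [lintegral_indicator_const (hA n), one_mul]

/-- A return of the reflection chain is a return of the walk. -/
lemma isRecurrentState_walkChain (h : IsRecurrentState P (reflectionChain Y) x) :
    IsRecurrentState P (walkChain Y) x := by
  filter_upwards [h] with ω hω
  obtain ⟨k, ⟨hk1, hk⟩, -⟩ := exists_of_returnTime_lt_top hω
  obtain ⟨n, hn, hnx⟩ := reflectionChain_eq_iff.1 hk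
  have hkn : k ≤ n := by
    have := le_reflectionTime Y x ω k
    rwa [hn, Nat.cast_le] at this
  exact (returnTime_le (Z := walkChain Y) (hk1.trans hkn) (congrArg _ hnx)).trans_lt
    (ENat.natCast_lt_top n)

lemma meanReturnTime_walkChain_lt_top [IsProbabilityMeasure P] [IsProbabilityMeasure μ]
    (hmeas : ∀ n, Measurable (Y n)) (hindep : iIndepFun Y P)
    (hlaw : ∀ n, P.map (Y n) = μ) (hκ : 0 < κ) (hlattice : ∀ᵐ y ∂μ, ∃ m : ℕ, y = κ * m)
    (hnondeg : μ ≠ Measure.dirac 0) (hx : x ∈ essentialClass μ x₀)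
    (hmean : ∫⁻ t, ENNReal.ofReal t ∂μ < ⊤) : meanReturnTime P (walkChain Y) x < ⊤ := by
  have hwalk := ae_walk_mem_essentialClass (x := x) hmeas hlaw hκ hlattice hnondeg hx
  have hD := essentialClass_countable μ x₀
  have hocc := mul_tsum_alive_le hmeas hindep hlaw hD hwalk (measurableSet_hitMoves x)
    (weight_hitMoves (ae_nonneg_of_lattice hκ hlattice))
  rw [meanReturnTime_walkChain_eq hmeas]
  have hmul : weight μ x * ∑' n, P (alive Y x (hitMoves x) n) < ⊤ := by
    calc weight μ x * ∑' n, P (alive Y x (hitMoves x) n)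
        ≤ weight μ x *
            ∑' n, ∑' w, P (alive Y x (hitMoves x) n ∩ {ω | walk Y x n ω = w}) := by
          gcongr with n
          exact measure_le_tsum_fiber hD (ae_all_iff.1 hwalk n) _
      _ = ∑' w, weight μ x * ∑' n, P (alive Y x (hitMoves x) n ∩ {ω | walk Y x n ω = w}) := by
          rw [ENNReal.tsum_comm, ← ENNReal.tsum_mul_left]
      _ ≤ ∑' w, (essentialClass μ x₀).indicator (weight μ) w := by
          refine ENNReal.tsum_le_tsum fun w => ?_
          by_cases hw : w ∈ essentialClass μ x₀
          · rw [Set.indicator_of_mem hw]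
            exact hocc w
          · simp [measure_inter_fiber_eq_zero hmeas hlaw hκ hlattice hnondeg hx _ _ hw]
      _ < ⊤ := tsum_weight_lt_top hκ hlattice hnondeg x₀ hmean
  exact ENNReal.lt_top_of_mul_ne_top_right hmul.ne
    (weight_ne_zero_of_mem hκ hlattice hnondeg hx)

lemma eq_zero_of_reach {l : ℝ → ENNReal}
    (hexc : ∀ y, ∑' w, l w * μ {s | |w - s| = y} ≤ l y) {y : ℝ}
    (hreach : Reach (atoms μ) y x) (hzero : l x = 0) : l y = 0 := by
  induction hreach using Relation.ReflTransGen.head_induction_on with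
  | refl => exact hzero
  | @head b c hbc _ ih =>
    obtain ⟨s, hs, rfl⟩ := hbc
    have h0 := ENNReal.tsum_eq_zero.1 (le_antisymm ((hexc _).trans_eq ih) zero_le) b
    refine (mul_eq_zero.1 h0).resolve_right fun h => hs (measure_mono_null ?_ h)
    exact Set.singleton_subset_iff.2 (show |b - s| = |b - s| from rfl)

/-- With an infinite mean increment the mean return time of the walk is infinite. The occupation
measure `π` of an excursion from `x` satisfies `π ≤ π p`, since the excursion ends almost surely,
so that `l = weight - weight x • π` is excessive. It vanishes at `x`, hence on the whole class by
irreducibility, and the total mass of the weight would be `weight x` times the mean return time. -/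
lemma meanReturnTime_walkChain_eq_top [IsProbabilityMeasure P] [IsProbabilityMeasure μ]
    (hmeas : ∀ n, Measurable (Y n)) (hindep : iIndepFun Y P)
    (hlaw : ∀ n, P.map (Y n) = μ) (hκ : 0 < κ) (hlattice : ∀ᵐ y ∂μ, ∃ m : ℕ, y = κ * m)
    (hnondeg : μ ≠ Measure.dirac 0) (hx : x ∈ essentialClass μ x₀)
    (hrec : IsRecurrentState P (walkChain Y) x)
    (hmean : ∫⁻ t, ENNReal.ofReal t ∂μ = ⊤) : meanReturnTime P (walkChain Y) x = ⊤ := by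
  have hwalk := ae_walk_mem_essentialClass (x := x) hmeas hlaw hκ hlattice hnondeg hx
  have hD := essentialClass_countable μ x₀
  have hKm := measurableSet_hitMoves x
  have hnn := ae_nonneg_of_lattice hκ hlattice
  have hocc := mul_tsum_alive_le hmeas hindep hlaw hD hwalk hKm (weight_hitMoves hnn)
  set π : ℝ → ENNReal := fun y => ∑' n, P (alive Y x (hitMoves x) n ∩ {ω | walk Y x n ω = y})
    with hπ
  by_contra hne
  rw [meanReturnTime_walkChain_eq hmeas] at hne
  have hπx : 1 ≤ π x := by
    refine le_trans ?_ (ENNReal.le_tsum 0)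
    rw [← measure_univ (μ := P)]
    exact measure_mono fun ω _ => ⟨fun m hm => absurd hm m.not_lt_zero, rfl⟩
  have hmove : ∀ n y, P (alive Y x (hitMoves x) n ∩ {ω | walk Y x (n + 1) ω = y}) ≤
      ∑' w, P (alive Y x (hitMoves x) n ∩ {ω | walk Y x n ω = w}) * μ {s | |w - s| = y} :=
    fun n y => measure_inter_move_le hmeas hindep hlaw hD (ae_all_iff.1 hwalk n)
      (measurableSet_alive_past hmeas x hKm n) (B := hitMoves y) (measurableSet_hitMoves y)
  have hsum : ∀ y, ∑' n, P (alive Y x (hitMoves x) n ∩ {ω | walk Y x (n + 1) ω = y}) ≤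
      ∑' w, π w * μ {s | |w - s| = y} := by
    intro y
    refine (ENNReal.tsum_le_tsum fun n => hmove n y).trans_eq ?_
    rw [ENNReal.tsum_comm]
    simp_rw [ENNReal.tsum_mul_right, hπ]
  -- At `x` the occupation measure has mass one and receives the end of the excursion.
  have hπx_le : π x ≤ 1 := by
    rw [hπ]
    dsimp only
    rw [tsum_eq_single 0]
    · exact prob_le_one
    · intro n hn
      obtain ⟨m, rfl⟩ := Nat.exists_eq_succ_of_ne_zero hn
      refine measure_mono_null ?_ measure_empty
      rintro ω ⟨h1, h2⟩
      exact h1 m m.lt_succ_self h2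
  have hsub : ∀ y, π y ≤ ∑' w, π w * μ {s | |w - s| = y} := by
    intro y
    refine le_trans ?_ (hsum y)
    by_cases hy : y = x
    · subst hy
      refine hπx_le.trans ?_
      have hone : P (⋃ n, alive Y y (hitMoves y) n ∩ {ω | walk Y y (n + 1) ω = y}) = 1 := by
        rw [← measure_univ (μ := P)]
        refine measure_congr (Filter.eventuallyEq_univ.2 ?_)
        filter_upwards [hrec] with ω hω
        obtain ⟨t, ⟨ht1, ht⟩, hteq⟩ := exists_of_returnTime_lt_top hω
        obtain ⟨m, rfl⟩ := Nat.exists_eq_add_of_le' ht1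
        refine Set.mem_iUnion.2 ⟨m, mem_alive_hitMoves_iff.2 ?_, WithTop.coe_injective ht⟩
        rw [hteq, Nat.cast_lt]
        exact m.lt_succ_self
      rw [← hone]
      exact measure_iUnion_le _
    · rw [hπ]
      dsimp only
      rw [tsum_eq_zero_add' ENNReal.summable]
      have h0 : P (alive Y x (hitMoves x) 0 ∩ {ω | walk Y x 0 ω = y}) = 0 := by
        refine measure_mono_null ?_ measure_empty
        rintro ω ⟨-, h⟩
        exact hy (Eq.symm h)
      rw [h0, zero_add]
      refine ENNReal.tsum_le_tsum fun n => measure_mono ?_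
      rintro ω ⟨h1, h2⟩
      exact ⟨fun m hm => h1 m (hm.trans n.lt_succ_self), h2⟩
  let l : ℝ → ENNReal := fun y => weight μ y - weight μ x * π y
  have hl : ∀ y, l y + weight μ x * π y = weight μ y := fun y => tsub_add_cancel_of_le (hocc y)
  have hexc : ∀ y, ∑' w, l w * μ {s | |w - s| = y} ≤ l y := by
    intro y
    have hfin : weight μ x * π y ≠ ⊤ := ne_top_of_le_ne_top (weight_ne_top y) (hocc y)
    refine (ENNReal.add_le_add_iff_right hfin).1 ?_
    rw [hl]
    calc ∑' w, l w * μ {s | |w - s| = y} + weight μ x * π y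
        ≤ ∑' w, l w * μ {s | |w - s| = y} +
            weight μ x * ∑' w, π w * μ {s | |w - s| = y} := by
          gcongr
          exact hsub y
      _ = ∑' w, weight μ w * μ {s | |w - s| = y} := by
          rw [← ENNReal.tsum_mul_left, ← ENNReal.tsum_add]
          refine tsum_congr fun w => ?_
          rw [← mul_assoc, ← add_mul, hl]
      _ ≤ weight μ y := tsum_weight_mul_le hnn y
  have hlx : l x = 0 := tsub_eq_zero_of_le (le_mul_of_one_le_right zero_le hπx)
  have hle : ∀ y, (essentialClass μ x₀).indicator (weight μ) y ≤ weight μ x * π y := by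
    intro y
    by_cases hy : y ∈ essentialClass μ x₀
    · rw [Set.indicator_of_mem hy, ← hl y, eq_zero_of_reach hexc
        (reach_of_mem_essentialClass hκ hlattice hnondeg hy hx) hlx, zero_add]
    · rw [Set.indicator_of_notMem hy]
      exact zero_le
  have htot : ∑' y, π y ≤ ∑' n, P (alive Y x (hitMoves x) n) := by
    rw [hπ, ENNReal.tsum_comm]
    exact ENNReal.tsum_le_tsum fun n =>
      tsum_fiber_le (measurable_walk hmeas x n) (measurableSet_alive hmeas x hKm n)
  have hbound := ENNReal.tsum_le_tsum hle
  rw [tsum_weight_eq_top hκ hlattice hnondeg x₀ hmean, ENNReal.tsum_mul_left] at hbound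
  exact ENNReal.mul_ne_top (weight_ne_top x) (ne_top_of_le_ne_top hne htot) (top_le_iff.1 hbound)

end Recurrence

end ReflectedWalk

theorem theorem3p6 {Ω : Type*} [MeasurableSpace Ω] (P : Measure Ω) [IsProbabilityMeasure P]
    (Y : ℕ → Ω → ℝ) (μ : Measure ℝ)
    (hmeas : ∀ n, Measurable (Y n))
    (hindep : iIndepFun Y P)
    (hlaw : ∀ n, P.map (Y n) = μ)
    (hnondeg : ∀ a : ℝ, μ ≠ Measure.dirac a)
    (κ : ℝ) (hκ : 0 < κ)
    (hlattice : ∀ᵐ y ∂μ, ∃ m : ℕ, y = κ * m)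
    (hquad : Summable (fun k : ℕ => (1 - cdf μ (κ * k)) ^ 2)) :
    ∀ x₀ : ℝ, 0 ≤ x₀ →
      ReflectedWalk.IsPositiveRecurrentOn P (ReflectedWalk.reflectionChain Y)
        (ReflectedWalk.essentialClass μ x₀) ∧
      (∫⁻ ω, ENNReal.ofReal (Y 1 ω) ∂P < ⊤ →
        ReflectedWalk.IsPositiveRecurrentOn P (ReflectedWalk.walkChain Y)
          (ReflectedWalk.essentialClass μ x₀)) ∧
      (∫⁻ ω, ENNReal.ofReal (Y 1 ω) ∂P = ⊤ →
        ReflectedWalk.IsNullRecurrentOn P (ReflectedWalk.walkChain Y)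
          (ReflectedWalk.essentialClass μ x₀)) := by
  have hprob : IsProbabilityMeasure μ := by
    rw [← hlaw 0]
    exact Measure.isProbabilityMeasure_map (hmeas 0).aemeasurable
  have hmean : ∫⁻ ω, ENNReal.ofReal (Y 1 ω) ∂P = ∫⁻ t, ENNReal.ofReal t ∂μ := by
    rw [← hlaw 1, lintegral_map ENNReal.measurable_ofReal (hmeas 1)]
  intro x₀ _
  have hrefl : ∀ x ∈ ReflectedWalk.essentialClass μ x₀,
      ReflectedWalk.IsRecurrentState P (ReflectedWalk.reflectionChain Y) x ∧
        ReflectedWalk.meanReturnTime P (ReflectedWalk.reflectionChain Y) x < ⊤ := fun x hx =>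
    ReflectedWalk.returnTime_reflectionChain_finite hmeas hindep hlaw hκ hlattice (hnondeg 0)
      hquad hx
  have hess := ReflectedWalk.isEssentialClass_walkChain hmeas hindep hlaw hκ hlattice (hnondeg 0) x₀
  refine ⟨⟨ReflectedWalk.isEssentialClass_reflectionChain hmeas hindep hlaw hκ hlattice
    (hnondeg 0) x₀, hrefl⟩, fun h => ⟨hess, fun x hx => ?_⟩, fun h => ⟨hess, fun x hx => ?_⟩⟩
  · exact ⟨ReflectedWalk.isRecurrentState_walkChain (hrefl x hx).1,
      ReflectedWalk.meanReturnTime_walkChain_lt_top hmeas hindep hlaw hκ hlattice (hnondeg 0) hx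
        (hmean ▸ h)⟩
  · have hrec := ReflectedWalk.isRecurrentState_walkChain (hrefl x hx).1
    exact ⟨hrec, ReflectedWalk.meanReturnTime_walkChain_eq_top hmeas hindep hlaw hκ hlattice
      (hnondeg 0) hx hrec (hmean ▸ h)⟩
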